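/- **Setting.** Graphs are finite and simple, on a vertex set $\{1,\dots,n\}$ with $n\ge 1$; $m$ is the number of edges. For a bitstring $b\in\{0,1\}^n$ let $\mathrm{cut}_G(b)$ be the number of edges $\{i,j\}$ with $b_i\ne b_j$, and $\mathrm{MaxCut}(G)=\max_b \mathrm{cut}_G(b)$. The cut $b$ is *1-BLS optimal* if changing any single bit of $b$ does not increase $\mathrm{cut}_G$. *Circuit.* For $\theta\in\mathbb R$ put $|0_\theta\rangle=\cos\frac\theta2|0\rangle+\sin\frac\theta2|1\rangle$, $|1_\theta\rangle=\sin\frac\theta2|0\rangle+\cos\frac\theta2|1\rangle$, $|b_\theta\rangle=\bigotimes_j|(b_j)_\theta\rangle$. Let $C_{ij}=\frac12(I-Z_iZ_j)$, $C_G=\sum_{ij\in E(G)}C_{ij}$, and $B_{b,\theta}=\sum_j(\sin\theta\,X_j+(-1)^{b_j}\cos\theta\,Z_j)$. The depth-1 output state is $|\psi_G\rangle=e^{-i\beta B_{b,\theta}}e^{-i\gamma C_G}|b_\theta\rangle$; let $F_G(\gamma,\beta,|b_\theta\rangle)=\langle\psi_G|C_G|\psi_G\rangle$. *Approximation ratio.*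 For a possibly randomized algorithm $\mathcal A$ that returns the bitstring $b$ on input $G$ with probability $\Pr_{\mathcal A}(G,b)$, and a non-empty class $\mathcal G$ of graphs, $$\alpha_{\mathcal A,\theta}(G)=\sum_b \Pr\nolimits_{\mathcal A}(G,b)\,\frac{\max_{\gamma,\beta\in\mathbb R}F_G(\gamma,\beta,|b_\theta\rangle)}{\mathrm{MaxCut}(G)},\qquad \alpha_{\mathcal A,\theta}=\inf_{G\in\mathcal G}\alpha_{\mathcal A,\theta}(G).$$ $\mathcal A$ is *of type $\mathcal A_\kappa$* on $\mathcal G$ if every $G\in\mathcal G$ is 3-regular and every $b$ with $\Pr_{\mathcal A}(G,b)>0$ is 1-BLS optimal with $\mathrm{cut}_G(b)\ge\kappa m$; it is *of type $\mathcal A'_\kappa$* if, moreover, every $G\in\mathcal G$ is triangle-free. *Colored edge neighborhoods.* Let $g_4,g_5,g_6$ be the graphs with edge sets $\{01,02,12,03,13\}$, $\{01,02,12,03,14\}$, $\{01,02,03,14,15\}$ on the vertices $0,1,2,\dots$, with central edge $01$. Color the vertices $0,1,2,\dots$ by the following bitstrings: $g_{4,1},g_{4,2},g_{4,3}$: $1100$,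 $0101$, $0011$; $g_{5,1},\dots,g_{5,6}$: $11000$, $01010$, $01100$, $01011$, $01110$, $00111$; $g_{6,1},\dots,g_{6,6}$: $110000$, $011000$, $011100$, $011010$, $011110$, $001111$. Let $f_g(\gamma,\beta,\theta)=\langle\psi_g|C_{01}|\psi_g\rangle$ be the probability that the central edge is cut when the circuit is run on $g$ with its coloring as $b$. For $\mathbf r=(r_1,\dots,r_6)$, $\mathbf s=(s_0,s_0',s_{1,1},s_{1,2},s_{1,3},s_2,s_2')$, $\mathbf t=(t_0,\dots,t_3)$ with entry sums $r,s,t$, put $$\begin{aligned}F_{\mathbf r,\mathbf s,\mathbf t}={}&(s_0'+s_2+s_{1,1})f_{g_{4,1}}+s_{1,2}f_{g_{4,2}}+(s_0+s_{1,3}+s_2')f_{g_{4,3}}+(t_0+t_1+s_{1,2})f_{g_{5,1}}\\&+(2t_2+4s_0+2s_{1,3})f_{g_{5,2}}+(2t_0+4s_0'+2s_{1,1}+s_{1,2})f_{g_{5,3}}+(2t_3+s_{1,2}+2s_{1,3}+4s_2')f_{g_{5,4}}\\&+(2t_1+2s_{1,1}+4s_2)f_{g_{5,5}}+(t_2+t_3+s_{1,2})f_{g_{5,6}}+\sum_{i=1}^6r_if_{g_{6,i}},\end{aligned}$$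 and $M_\theta(\mathbf r,\mathbf s,\mathbf t)=\max_{\gamma,\beta\in\mathbb R}F_{\mathbf r,\mathbf s,\mathbf t}(\gamma,\beta,\theta)$. Let $$\mathcal P(\kappa)=\{(\mathbf r,\mathbf s,\mathbf t)\in\mathbb R^{17}_{\ge0}: 5s+3t+r=1,\ 4s+3t\le\tfrac23,\ r_1,r_6\le\tfrac15,\ s+t+s_{1,2}+r_1+r_6\le1-\kappa\},$$ $$\mathcal P'(\kappa)=\{\mathbf r\in\mathbb R^6_{\ge0}: r=1,\ r_1,r_6\le\tfrac15,\ r_1+r_6\le1-\kappa\}.$$ **Theorem.** Let $\theta\in\mathbb R$ and $\kappa\le1$. All maxima and minima written here are attained, and: (a) if $\mathcal A$ is of type $\mathcal A_\kappa$ on a non-empty class $\mathcal G$ of graphs none of which contains $K_4$ (for 3-regular graphs: none of which has a connected component isomorphic to $K_4$), then $$\alpha_{\mathcal A,\theta}\ \ge\ \min_{(\mathbf r,\mathbf s,\mathbf t)\in\mathcal P(\kappa)}\frac{M_\theta(\mathbf r,\mathbf s,\mathbf t)}{1-s-t}\ \ge\ \mathbf{LB}_\kappa(\theta):=\max_{\gamma,\beta}\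 \min_{(\mathbf r,\mathbf s,\mathbf t)\in\mathcal P(\kappa)}\frac{F_{\mathbf r,\mathbf s,\mathbf t}(\gamma,\beta,\theta)}{1-s-t};$$ (b) if $\mathcal A$ is of type $\mathcal A'_\kappa$ on a non-empty class $\mathcal G$, then $$\alpha_{\mathcal A,\theta}\ \ge\ \min_{\mathbf r\in\mathcal P'(\kappa)}M_\theta(\mathbf r,\mathbf 0,\mathbf 0)\ \ge\ \mathbf{LB}'_\kappa(\theta):=\max_{\gamma,\beta}\ \min_{\mathbf r\in\mathcal P'(\kappa)}F_{\mathbf r,\mathbf 0,\mathbf 0}(\gamma,\beta,\theta).$$ The second inequality in each chain holds for every $\kappa\le1$, whether or not such an algorithm exists. -/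

import Mathlib

open scoped Matrix

noncomputable section

namespace WarmStartQAOA

/-! ## Cuts, local optimality -/

section Cuts

variable {V : Type*} [Fintype V] [DecidableEq V]

/-- The edge `e` is cut by the bitstring `b`: its two endpoints carry different bits. -/
def IsCut (b : V → Fin 2) (e : Sym2 V) : Prop := ¬ (e.map b).IsDiag

open Classical in
/-- The set of edges of `G`, as a finset. -/
def edges (G : SimpleGraph V) : Finset (Sym2 V) := Finset.univ.filter (fun e => e ∈ G.edgeSet)

open Classical in
/-- `cut_G(b)`: the number of edges of `G` cut by `b`. -/
def cut (G : SimpleGraph V) (b : V → Fin 2) : ℕ := ((edges G).filter (fun e => IsCut b e)).card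

/-- `Max-Cut(G)`. -/
def maxCut (G : SimpleGraph V) : ℕ := Finset.univ.sup (fun b : V → Fin 2 => cut G b)

/-- `b` is locally `k`-BLS optimal for Max-Cut on `G`: no bitstring at Hamming distance at most
`k` from `b` has a larger cut value. -/
def IsBLSOptimal (k : ℕ) (G : SimpleGraph V) (b : V → Fin 2) : Prop :=
  ∀ b' : V → Fin 2, hammingDist b b' ≤ k → cut G b' ≤ cut G b

end Cuts

/-! ## Depth-1 warm-started Max-Cut QAOA -/

section Circuit

variable {V : Type*} [Fintype V] [DecidableEq V]

/-- Operators on the qubits indexed by `V`, as matrices in the computational basis. -/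
abbrev Op (V : Type*) := Matrix (V → Fin 2) (V → Fin 2) ℂ

def pauliX : Matrix (Fin 2) (Fin 2) ℂ := !![0, 1; 1, 0]
def pauliY : Matrix (Fin 2) (Fin 2) ℂ := !![0, -Complex.I; Complex.I, 0]
def pauliZ : Matrix (Fin 2) (Fin 2) ℂ := !![1, 0; 0, -1]

open Classical in
/-- The single-qubit operator `A` applied to the qubit `j` (identity on all other qubits). -/
def onQubit (j : V) (A : Matrix (Fin 2) (Fin 2) ℂ) : Op V :=
  Matrix.of fun x y => if ∀ i, i ≠ j → x i = y i then A (x j) (y j) else 0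

open Classical in
/-- `C_e`, the diagonal observable indicating whether the edge `e` is cut. -/
def edgeCost (e : Sym2 V) : Op V := Matrix.diagonal fun x => if IsCut x e then 1 else 0

/-- `C_{ij} = (I - Z_i Z_j) / 2`. -/
theorem edgeCost_eq_pauli (i j : V) :
    edgeCost s(i, j) = (1 / 2 : ℂ) • (1 - onQubit i pauliZ * onQubit j pauliZ) := by
  have hdiag : ∀ k : V, onQubit k pauliZ =
      Matrix.diagonal (fun x : V → Fin 2 => pauliZ (x k) (x k)) := by
    intro k
    ext x y
    by_cases hxy : x = y
    · subst hxy; simp [onQubit]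
    · rw [Matrix.diagonal_apply_ne _ hxy]
      simp only [onQubit, Matrix.of_apply]
      split_ifs with h
      · have hk : x k ≠ y k := by
          intro hk
          apply hxy
          funext i
          by_cases hi : i = k
          · rw [hi, hk]
          · exact h i hi
        revert hk
        generalize x k = a
        generalize y k = c
        fin_cases a <;> fin_cases c <;> simp [pauliZ]
      · rfl
  rw [hdiag, hdiag, Matrix.diagonal_mul_diagonal]
  ext x y
  by_cases hxy : x = y
  · subst hxy
    simp only [edgeCost, IsCut, Matrix.diagonal_apply_eq, Matrix.smul_apply, Matrix.sub_apply,
      Matrix.one_apply_eq, Sym2.map_mk, Sym2.mk_isDiag_iff, smul_eq_mul]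
    generalize x i = a
    generalize x j = c
    fin_cases a <;> fin_cases c <;> norm_num [pauliZ]
  · simp [edgeCost, Matrix.diagonal_apply_ne _ hxy, Matrix.one_apply_ne hxy]

/-- The Max-Cut cost Hamiltonian `C_G = ∑_{e ∈ E(G)} C_e`. -/
def costHamiltonian (G : SimpleGraph V) : Op V := ∑ e ∈ edges G, edgeCost e

/-- `U(M, t) = exp(-i t M)`. -/
def U (M : Op V) (t : ℝ) : Op V := NormedSpace.exp ((-(Complex.I * (t : ℂ))) • M)

/-- The single-qubit states `|0_θ⟩` and `|1_θ⟩`. -/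
def qubitState (θ : ℝ) (a : Fin 2) : Fin 2 → ℂ :=
  if a = 0 then ![(Real.cos (θ / 2) : ℂ), (Real.sin (θ / 2) : ℂ)]
  else ![(Real.sin (θ / 2) : ℂ), (Real.cos (θ / 2) : ℂ)]

/-- The warm start `|b_θ⟩ = ⨂_j |(b_j)_θ⟩`. -/
def warmStart (θ : ℝ) (b : V → Fin 2) : (V → Fin 2) → ℂ := fun x => ∏ j, qubitState θ (b j) (x j)

/-- The Bloch vector `(x, y, z)` of `|a_θ⟩`. -/
def blochVector (θ : ℝ) (a : Fin 2) : Fin 3 → ℝ :=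
  if a = 0 then ![Real.sin θ, 0, Real.cos θ] else ![Real.sin θ, 0, -Real.cos θ]

/-- `B_n = x X + y Y + z Z` for `n = (x, y, z)`. -/
def pauliDot (n : Fin 3 → ℝ) : Matrix (Fin 2) (Fin 2) ℂ :=
  (n 0 : ℂ) • pauliX + (n 1 : ℂ) • pauliY + (n 2 : ℂ) • pauliZ

/-- The mixer `B_{|b_θ⟩} = ∑_j B_{n_j, j}` aligned with the warm start. -/
def alignedMixer (θ : ℝ) (b : V → Fin 2) : Op V :=
  ∑ j, onQubit j (pauliDot (blochVector θ (b j)))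

/-- The output `U(B, β) U(C, γ) |b_θ⟩` of the depth-1 warm-started Max-Cut QAOA circuit on `G`. -/
def outputState (G : SimpleGraph V) (b : V → Fin 2) (θ γ β : ℝ) : (V → Fin 2) → ℂ :=
  U (alignedMixer θ b) β *ᵥ (U (costHamiltonian G) γ *ᵥ warmStart θ b)

/-- `⟨ψ| M |ψ⟩` (real for Hermitian `M`). -/
def expectation (M : Op V) (ψ : (V → Fin 2) → ℂ) : ℝ := (star ψ ⬝ᵥ (M *ᵥ ψ)).re

/-- `F_G(γ, β, |b_θ⟩)`: the expected cut value of the output. -/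
def expectedCut (G : SimpleGraph V) (b : V → Fin 2) (θ γ β : ℝ) : ℝ :=
  expectation (costHamiltonian G) (outputState G b θ γ β)

/-- The probability that the edge `e` is cut by a measurement of the output. -/
def edgeCutProb (G : SimpleGraph V) (b : V → Fin 2) (e : Sym2 V) (θ γ β : ℝ) : ℝ :=
  expectation (edgeCost e) (outputState G b θ γ β)

/-- `M_1(|b_θ⟩)`: the expected cut value at optimal variational parameters. -/
def optExpectedCut (G : SimpleGraph V) (b : V → Fin 2) (θ : ℝ) : ℝ :=
  ⨆ x : ℝ × ℝ, expectedCut G b θ x.1 x.2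

/-- The instance-specific ratio `M_1(|b_θ⟩) / Max-Cut(G)` for the cut `b`. -/
def warmStartRatio (G : SimpleGraph V) (b : V → Fin 2) (θ : ℝ) : ℝ :=
  optExpectedCut G b θ / (maxCut G : ℝ)

end Circuit

/-! ## Classical algorithms and approximation ratios -/

/-- Graphs on a vertex set `{1, …, n}`. -/
abbrev Graph := Σ n : ℕ, SimpleGraph (Fin n)

/-- A (possibly randomized) Max-Cut algorithm: to each graph, a distribution on bitstrings. -/
abbrev CutAlgorithm := ∀ G : Graph, PMF (Fin G.1 → Fin 2)

open Classical in
/-- `A` is of type `𝒜_κ` on the class `𝒢` of admissible inputs: these are 3-regular graphs, and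
every cut that `A` may return on them is 1-BLS optimal and contains at least a fraction `κ` of
the edges. -/
def IsTypeA (κ : ℝ) (𝒢 : Set Graph) (A : CutAlgorithm) : Prop :=
  ∀ G ∈ 𝒢, G.2.IsRegularOfDegree 3 ∧
    ∀ b ∈ (A G).support, κ ≤ (cut G.2 b : ℝ) / ((edges G.2).card : ℝ) ∧ IsBLSOptimal 1 G.2 b

/-- `A` is of type `𝒜'_κ` on `𝒢`: moreover all admissible inputs are triangle-free. -/
def IsTypeA' (κ : ℝ) (𝒢 : Set Graph) (A : CutAlgorithm) : Prop :=
  IsTypeA κ 𝒢 A ∧ ∀ G ∈ 𝒢, G.2.CliqueFree 3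

/-- The instance-specific approximation ratio of `A` followed by depth-1 warm-started QAOA, in
expectation over the cut returned by `A`. -/
def instanceRatio (A : CutAlgorithm) (θ : ℝ) (G : Graph) : ℝ :=
  ∑ b : Fin G.1 → Fin 2, (A G b).toReal * warmStartRatio G.2 b θ

/-- The approximation ratio over the class `𝒢`. -/
def approxRatio (A : CutAlgorithm) (θ : ℝ) (𝒢 : Set Graph) : ℝ := sInf (instanceRatio A θ '' 𝒢)

/-! ## The 15 colored edge neighborhoods

The central edge is always `s(0, 1)`. -/

/-- Both endpoints of the central edge are adjacent to both other vertices. -/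
def g4 : SimpleGraph (Fin 4) :=
  SimpleGraph.fromEdgeSet {s(0, 1), s(0, 2), s(1, 2), s(0, 3), s(1, 3)}

/-- The endpoints of the central edge have the common neighbor `2`; the third neighbors of `0`
and `1` are `3` and `4`. -/
def g5 : SimpleGraph (Fin 5) :=
  SimpleGraph.fromEdgeSet {s(0, 1), s(0, 2), s(1, 2), s(0, 3), s(1, 4)}

/-- The endpoints of the central edge have no common neighbor; the other neighbors of `0` are
`2, 3` and those of `1` are `4, 5`. -/
def g6 : SimpleGraph (Fin 6) :=
  SimpleGraph.fromEdgeSet {s(0, 1), s(0, 2), s(0, 3), s(1, 4), s(1, 5)}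

/-- The colorings `g_{4,1}, g_{4,2}, g_{4,3}`. -/
def color4 : Fin 3 → Fin 4 → Fin 2 :=
  ![![1, 1, 0, 0], ![0, 1, 0, 1], ![0, 0, 1, 1]]

/-- The colorings `g_{5,1}, …, g_{5,6}`. -/
def color5 : Fin 6 → Fin 5 → Fin 2 :=
  ![![1, 1, 0, 0, 0], ![0, 1, 0, 1, 0], ![0, 1, 1, 0, 0],
    ![0, 1, 0, 1, 1], ![0, 1, 1, 1, 0], ![0, 0, 1, 1, 1]]

/-- The colorings `g_{6,1}, …, g_{6,6}`. -/
def color6 : Fin 6 → Fin 6 → Fin 2 :=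
  ![![1, 1, 0, 0, 0, 0], ![0, 1, 1, 0, 0, 0], ![0, 1, 1, 1, 0, 0],
    ![0, 1, 1, 0, 1, 0], ![0, 1, 1, 1, 1, 0], ![0, 0, 1, 1, 1, 1]]

/-- `f_{g_{4,i+1}}(γ, β, θ)`. -/
def f4 (i : Fin 3) (θ γ β : ℝ) : ℝ := edgeCutProb g4 (color4 i) s(0, 1) θ γ β

/-- `f_{g_{5,i+1}}(γ, β, θ)`. -/
def f5 (i : Fin 6) (θ γ β : ℝ) : ℝ := edgeCutProb g5 (color5 i) s(0, 1) θ γ β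

/-- `f_{g_{6,i+1}}(γ, β, θ)`. -/
def f6 (i : Fin 6) (θ γ β : ℝ) : ℝ := edgeCutProb g6 (color6 i) s(0, 1) θ γ β

/-! ## The optimization problems -/

/-- The triples `(𝐫, 𝐬, 𝐭)` with `𝐫 = (r₁, …, r₆)`,
`𝐬 = (s₀, s₀', s₁₁, s₁₂, s₁₃, s₂, s₂')` and `𝐭 = (t₀, t₁, t₂, t₃)`. -/
abbrev Params := (Fin 6 → ℝ) × (Fin 7 → ℝ) × (Fin 4 → ℝ)

/-- `F_{𝐫,𝐬,𝐭}(γ, β, θ)`. -/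
def F (p : Params) (θ γ β : ℝ) : ℝ :=
  let r := p.1
  let s0 := p.2.1 0
  let s0' := p.2.1 1
  let s11 := p.2.1 2
  let s12 := p.2.1 3
  let s13 := p.2.1 4
  let s2 := p.2.1 5
  let s2' := p.2.1 6
  let t := p.2.2
  (s0' + s2 + s11) * f4 0 θ γ β
  + s12 * f4 1 θ γ β
  + (s0 + s13 + s2') * f4 2 θ γ β
  + (t 0 + t 1 + s12) * f5 0 θ γ β
  + (2 * t 2 + 4 * s0 + 2 * s13) * f5 1 θ γ β
  + (2 * t 0 + 4 * s0' + 2 * s11 + s12) * f5 2 θ γ β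
  + (2 * t 3 + s12 + 2 * s13 + 4 * s2') * f5 3 θ γ β
  + (2 * t 1 + 2 * s11 + 4 * s2) * f5 4 θ γ β
  + (t 2 + t 3 + s12) * f5 5 θ γ β
  + ∑ i, r i * f6 i θ γ β

/-- `M_θ(𝐫, 𝐬, 𝐭) = max_{γ,β} F_{𝐫,𝐬,𝐭}(γ, β, θ)`. -/
def M (θ : ℝ) (p : Params) : ℝ := ⨆ x : ℝ × ℝ, F p θ x.1 x.2

/-- The denominator `1 - s - t`, with `s` and `t` the sums of the entries of `𝐬` and `𝐭`. -/
def denom (p : Params) : ℝ := 1 - ∑ i, p.2.1 i - ∑ i, p.2.2 i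

/-- The polytope `𝒫(κ)`. -/
def P (κ : ℝ) : Set Params :=
  {p | (∀ i, 0 ≤ p.1 i) ∧ (∀ i, 0 ≤ p.2.1 i) ∧ (∀ i, 0 ≤ p.2.2 i) ∧
    5 * ∑ i, p.2.1 i + 3 * ∑ i, p.2.2 i + ∑ i, p.1 i = 1 ∧
    4 * ∑ i, p.2.1 i + 3 * ∑ i, p.2.2 i ≤ 2 / 3 ∧
    p.1 0 ≤ 1 / 5 ∧ p.1 5 ≤ 1 / 5 ∧
    ∑ i, p.2.1 i + ∑ i, p.2.2 i + p.2.1 3 + p.1 0 + p.1 5 ≤ 1 - κ}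

/-- The polytope `𝒫'(κ)`. -/
def P' (κ : ℝ) : Set (Fin 6 → ℝ) :=
  {r | (∀ i, 0 ≤ r i) ∧ ∑ i, r i = 1 ∧ r 0 ≤ 1 / 5 ∧ r 5 ≤ 1 / 5 ∧ r 0 + r 5 ≤ 1 - κ}

/-- `min_{(𝐫,𝐬,𝐭) ∈ 𝒫(κ)} M_θ(𝐫,𝐬,𝐭) / (1 - s - t)`. -/
def minMax (κ θ : ℝ) : ℝ := sInf ((fun p => M θ p / denom p) '' P κ)

/-- `min_{(𝐫,𝐬,𝐭) ∈ 𝒫(κ)} F_{𝐫,𝐬,𝐭}(γ, β, θ) / (1 - s - t)`. -/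
def innerMin (κ θ : ℝ) (x : ℝ × ℝ) : ℝ := sInf ((fun p => F p θ x.1 x.2 / denom p) '' P κ)

/-- `LB_κ(θ)`. -/
def LB (κ θ : ℝ) : ℝ := ⨆ x : ℝ × ℝ, innerMin κ θ x

/-- `min_{𝐫 ∈ 𝒫'(κ)} M_θ(𝐫, 𝟎, 𝟎)`. -/
def minMax' (κ θ : ℝ) : ℝ := sInf ((fun r => M θ (r, 0, 0)) '' P' κ)

/-- `min_{𝐫 ∈ 𝒫'(κ)} F_{𝐫,𝟎,𝟎}(γ, β, θ)`. -/
def innerMin' (κ θ : ℝ) (x : ℝ × ℝ) : ℝ := sInf ((fun r => F (r, 0, 0) θ x.1 x.2) '' P' κ)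

/-- `LB'_κ(θ)`. -/
def LB' (κ θ : ℝ) : ℝ := ⨆ x : ℝ × ℝ, innerMin' κ θ x

end WarmStartQAOA

end

/-! The expected cut is a sum of cut probabilities over the edges, and each probability is local. A
mixer on a qubit other than the endpoints of `uv` cancels against its adjoint, and the phases of
edges away from `u` and `v` cancel too. What remains of the expectation of `Z_u Z_v` is a sum, over
the bits of `u` and `v` before and after the observable, of a product over the other qubits, in
which a qubit adjacent to neither endpoint contributes 1 (`edgeCutProb_formula`). So the probability
depends only on the colored graph of the edges meeting `uv` (`edgeCutProb_eq_of_embedding`).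

In a cubic graph, 1-BLS optimality forces the uncut edges to form a matching
(`hasUncutMatching_of_isBLSOptimal`). Up to symmetries of the uncolored neighborhoods this leaves
only the 15 listed colorings. Without `K₄`, every edge lying in a triangle belongs to exactly one
block, a diamond or an isolated triangle. The colors of a block and of its outer neighbors fix the
neighborhoods of all its edges, which gives 7 kinds of diamonds and 4 of triangles. Hence the sum
over the edges of any function of the colored neighborhood is one linear form in the counts of these
kinds and of the triangle-free edges (`exists_counts`).

After division by `m` the counts form a point of `𝒫(κ)`. The identity for cut probabilities gives
`F`, for the constant 1 the equation `5s + 3t + r = 1`, and for indicators of monochromatic edges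
the last three constraints: for one color, distinct uncut edges meet disjoint sets of five edges,
and there are at most `(1 - κ)m` uncut edges in total. Disjointness of the blocks gives `4s + 3t ≤
n/m = 2/3`. Every bitstring leaves an edge of each block uncut, so the maximum cut is at most `m(1 -
s - t)`. The ratio for each returned cut is therefore at least `M / (1 - s - t)` at a point of the
polytope. Averaging over cuts and taking the infimum preserve the bound. Triangle-free graphs have
no blocks, so their points lie on the face `𝒫'(κ)`.

Extrema are attained because the angles may be restricted to a compact period square and the
polytopes are compact. The second inequalities are the weak max-min inequality. -/

noncomputable section

namespace WarmStartQAOA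

/-! ### Tensor products of single-qubit operators and their exponentials -/

section TensorOperators

variable {V : Type*} [Fintype V]

/-- The tensor product `⨂_j A_j` of single-qubit operators. -/
def tensorOp (A : V → Matrix (Fin 2) (Fin 2) ℂ) : Op V :=
  Matrix.of fun x y => ∏ j, A j (x j) (y j)

theorem tensorOp_apply (A : V → Matrix (Fin 2) (Fin 2) ℂ) (x y : V → Fin 2) :
    tensorOp A x y = ∏ j, A j (x j) (y j) := rfl

theorem tensorOp_conjTranspose (A : V → Matrix (Fin 2) (Fin 2) ℂ) :
    (tensorOp A)ᴴ = tensorOp (fun j => (A j)ᴴ) := by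
  ext x y
  simp [tensorOp_apply, Matrix.conjTranspose_apply]

theorem tensorOp_one : tensorOp (fun _ : V => (1 : Matrix (Fin 2) (Fin 2) ℂ)) = 1 := by
  ext x y
  rw [tensorOp_apply]
  by_cases h : x = y
  · subst h; simp
  · obtain ⟨j, hj⟩ := Function.ne_iff.1 h
    rw [Matrix.one_apply_ne h]
    exact Finset.prod_eq_zero (Finset.mem_univ j) (Matrix.one_apply_ne hj)

variable [DecidableEq V]

theorem tensorOp_mul (A B : V → Matrix (Fin 2) (Fin 2) ℂ) :
    tensorOp A * tensorOp B = tensorOp (fun j => A j * B j) := by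
  ext x y
  simp only [Matrix.mul_apply, tensorOp_apply, ← Finset.prod_mul_distrib]
  rw [Finset.prod_univ_sum, Fintype.piFinset_univ]

theorem onQubit_eq_tensorOp (j : V) (A : Matrix (Fin 2) (Fin 2) ℂ) :
    onQubit j A = tensorOp (fun i => if i = j then A else 1) := by
  ext x y
  simp only [onQubit, Matrix.of_apply, tensorOp_apply]
  rw [← Finset.mul_prod_erase _ _ (Finset.mem_univ j)]
  simp only [if_true]
  split_ifs with h
  · rw [Finset.prod_eq_one, mul_one]
    intro i hi
    have hij := Finset.ne_of_mem_erase hi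
    rw [if_neg hij, h i hij, Matrix.one_apply_eq]
  · push Not at h
    obtain ⟨i, hij, hi⟩ := h
    rw [Finset.prod_eq_zero (i := i), mul_zero]
    · simp [hij]
    · simp [hij, hi]

/-- `A ↦ A_j` as a ring homomorphism. -/
def onQubitHom (j : V) : Matrix (Fin 2) (Fin 2) ℂ →+* Op V where
  toFun := onQubit j
  map_one' := by simp [onQubit_eq_tensorOp, tensorOp_one]
  map_mul' A B := by
    simp only [onQubit_eq_tensorOp, tensorOp_mul]
    congr 1; ext1 i; split_ifs <;> simp
  map_zero' := by ext x y; simp [onQubit]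
  map_add' A B := by ext x y; simp only [onQubit, Matrix.of_apply, Matrix.add_apply]; split_ifs <;> simp

theorem onQubit_commute {i j : V} (hij : i ≠ j) (A B : Matrix (Fin 2) (Fin 2) ℂ) :
    Commute (onQubit i A) (onQubit j B) := by
  simp only [Commute, SemiconjBy, onQubit_eq_tensorOp, tensorOp_mul]
  congr 1; ext1 k; split_ifs <;> simp_all

theorem onQubit_smul (j : V) (c : ℂ) (A : Matrix (Fin 2) (Fin 2) ℂ) :
    onQubit j (c • A) = c • onQubit j A := by
  ext x y; simp only [onQubit, Matrix.of_apply, Matrix.smul_apply]; split_ifs <;> simp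

open scoped Matrix.Norms.Operator in
-- A continuous ring homomorphism commutes with the exponential series.
theorem exp_onQubit (j : V) (A : Matrix (Fin 2) (Fin 2) ℂ) :
    NormedSpace.exp (onQubit j A) = onQubit j (NormedSpace.exp A) := by
  have hc : Continuous (onQubitHom j) := by
    refine continuous_matrix fun x y => ?_
    change Continuous fun A => onQubit j A x y
    simp only [onQubit, Matrix.of_apply]
    split_ifs <;> fun_prop
  exact (NormedSpace.map_exp (onQubitHom j) hc A).symm

/-- Operators on different qubits commute, so the exponential of the sum splits into a product with
one factor per qubit. -/
theorem exp_sum_onQubit (A : V → Matrix (Fin 2) (Fin 2) ℂ) :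
    NormedSpace.exp (∑ j, onQubit j (A j)) = tensorOp (fun j => NormedSpace.exp (A j)) := by
  suffices h : ∀ s : Finset V, NormedSpace.exp (∑ j ∈ s, onQubit j (A j)) =
      tensorOp (fun j => if j ∈ s then NormedSpace.exp (A j) else 1) by simpa using h Finset.univ
  intro s
  induction s using Finset.induction_on with
  | empty => simp [tensorOp_one]
  | insert j s hj ih =>
    rw [Finset.sum_insert hj, Matrix.exp_add_of_commute, ih, exp_onQubit, onQubit_eq_tensorOp,
      tensorOp_mul]
    · congr 1; ext1 k
      by_cases hk : k = j
      · subst hk; simp [hj]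
      · simp [hk]
    · exact Commute.sum_right _ _ _ fun i hi =>
        onQubit_commute (fun h : j = i => hj (by rwa [h])) _ _

end TensorOperators

/-! ### The circuit unitaries: explicit form, continuity and periodicity -/

section Circuit

variable {V : Type*} [Fintype V]

/-- The cost Hamiltonian is diagonal, with the cut values as entries. -/
theorem costHamiltonian_eq_diagonal (G : SimpleGraph V) :
    costHamiltonian G = Matrix.diagonal fun x => (cut G x : ℂ) := by
  classical
  ext x y
  rw [costHamiltonian, Matrix.sum_apply]
  by_cases h : x = y
  · subst h
    simp [edgeCost, cut]
  · simp [edgeCost, Matrix.diagonal_apply_ne _ h]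

variable [DecidableEq V]

/-- The single-qubit mixing unitary for the bit `a`. -/
def qubitMixer (θ β : ℝ) (a : Fin 2) : Matrix (Fin 2) (Fin 2) ℂ :=
  NormedSpace.exp ((-(Complex.I * (β : ℂ))) • pauliDot (blochVector θ a))

theorem U_alignedMixer (θ β : ℝ) (b : V → Fin 2) :
    U (alignedMixer θ b) β = tensorOp (fun j => qubitMixer θ β (b j)) := by
  simp only [U, alignedMixer, Finset.smul_sum, ← onQubit_smul, exp_sum_onQubit, qubitMixer]

theorem pauliDot_isHermitian (n : Fin 3 → ℝ) : (pauliDot n).IsHermitian := by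
  ext i j
  fin_cases i <;> fin_cases j <;> simp [pauliDot, pauliX, pauliY, pauliZ]

theorem qubitMixer_conjTranspose_mul (θ β : ℝ) (a : Fin 2) :
    (qubitMixer θ β a)ᴴ * qubitMixer θ β a = 1 := by
  rw [qubitMixer, ← Matrix.exp_conjTranspose, Matrix.conjTranspose_smul,
    (pauliDot_isHermitian _).eq, ← Matrix.exp_add_of_commute, ← add_smul]
  · simp
  · exact ((Commute.refl _).smul_left _).smul_right _

theorem U_costHamiltonian (G : SimpleGraph V) (γ : ℝ) :
    U (costHamiltonian G) γ =
      Matrix.diagonal fun x => Complex.exp (-(Complex.I * γ) * (cut G x : ℂ)) := by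
  rw [U, costHamiltonian_eq_diagonal, ← Matrix.diagonal_smul, Matrix.exp_diagonal]
  congr 1; ext x
  simp [Pi.coe_exp, Complex.exp_eq_exp_ℂ]

/-- The rotation taking the computational basis to the eigenbasis of the aligned mixer. -/
def mixerBasis (θ : ℝ) (a : Fin 2) : Matrix (Fin 2) (Fin 2) ℂ :=
  !![qubitState θ a 0, -qubitState θ a 1; qubitState θ a 1, qubitState θ a 0]

theorem qubitState_sq_add_sq (θ : ℝ) (a : Fin 2) :
    qubitState θ a 0 * qubitState θ a 0 + qubitState θ a 1 * qubitState θ a 1 = 1 := by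
  have h : (Real.cos (θ / 2) : ℂ) * Real.cos (θ / 2) + Real.sin (θ / 2) * Real.sin (θ / 2) = 1 := by
    exact_mod_cast (by nlinarith [Real.cos_sq_add_sin_sq (θ / 2)] :
      Real.cos (θ / 2) * Real.cos (θ / 2) + Real.sin (θ / 2) * Real.sin (θ / 2) = 1)
  fin_cases a
  · simpa [qubitState] using h
  · simpa [qubitState, add_comm] using h

theorem mixerBasis_mul_transpose (θ : ℝ) (a : Fin 2) :
    mixerBasis θ a * (mixerBasis θ a)ᵀ = 1 := by
  have h := qubitState_sq_add_sq θ a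
  ext i j
  fin_cases i <;> fin_cases j <;>
    simp [mixerBasis, Matrix.mul_apply, Fin.sum_univ_two] <;> first | linear_combination h | ring

theorem pauliDot_blochVector (θ : ℝ) (a : Fin 2) :
    pauliDot (blochVector θ a) = mixerBasis θ a * pauliZ * (mixerBasis θ a)ᵀ := by
  have hs : (Real.sin θ : ℂ) = 2 * Real.sin (θ / 2) * Real.cos (θ / 2) := by
    exact_mod_cast (by rw [← Real.sin_two_mul]; ring_nf :
      Real.sin θ = 2 * Real.sin (θ / 2) * Real.cos (θ / 2))
  have hc : (Real.cos θ : ℂ) =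
      Real.cos (θ / 2) * Real.cos (θ / 2) - Real.sin (θ / 2) * Real.sin (θ / 2) := by
    exact_mod_cast (by rw [← sq, ← sq, ← Real.cos_two_mul']; ring_nf :
      Real.cos θ = Real.cos (θ / 2) * Real.cos (θ / 2) - Real.sin (θ / 2) * Real.sin (θ / 2))
  ext i j
  fin_cases a <;> fin_cases i <;> fin_cases j <;>
    simp only [pauliDot, mixerBasis, pauliX, pauliY, pauliZ, blochVector, qubitState] <;>
    simp [Matrix.mul_apply, Fin.sum_univ_two, -Complex.ofReal_sin, -Complex.ofReal_cos, hs, hc] <;>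
    ring

/-- The state `|a_θ⟩` and its orthogonal complement diagonalize the aligned mixer with eigenvalues
`1` and `-1`. The angle `β` thus enters only through `exp (∓iβ)`, from which continuity and
`2π`-periodicity can be read off. -/
theorem qubitMixer_eq (θ β : ℝ) (a : Fin 2) :
    qubitMixer θ β a = mixerBasis θ a *
      Matrix.diagonal ![Complex.exp (-(Complex.I * β)), Complex.exp (Complex.I * β)] *
      (mixerBasis θ a)ᵀ := by
  have hinv : (mixerBasis θ a)⁻¹ = (mixerBasis θ a)ᵀ :=
    Matrix.inv_eq_right_inv (mixerBasis_mul_transpose θ a)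
  have hunit : IsUnit (mixerBasis θ a) :=
    IsUnit.of_mul_eq_one _ (mixerBasis_mul_transpose θ a)
  have hz : (-(Complex.I * (β : ℂ))) • pauliZ =
      Matrix.diagonal ![-(Complex.I * (β : ℂ)), Complex.I * β] := by
    ext i j; fin_cases i <;> fin_cases j <;> simp [pauliZ]
  rw [qubitMixer, pauliDot_blochVector, ← smul_mul_assoc, ← mul_smul_comm, ← hinv,
    Matrix.exp_conj _ _ hunit, hz, Matrix.exp_diagonal]
  congr 3
  ext i; fin_cases i <;> simp [Pi.coe_exp, Complex.exp_eq_exp_ℂ]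

theorem continuous_qubitMixer (θ : ℝ) (a : Fin 2) : Continuous fun β => qubitMixer θ β a := by
  simp only [qubitMixer_eq]
  refine (Continuous.matrix_mul continuous_const ?_).matrix_mul continuous_const
  refine Continuous.matrix_diagonal (continuous_pi fun i => ?_)
  fin_cases i <;> simp <;> fun_prop

theorem qubitMixer_periodic (θ β : ℝ) (a : Fin 2) :
    qubitMixer θ (β + 2 * Real.pi) a = qubitMixer θ β a := by
  rw [qubitMixer_eq, qubitMixer_eq]
  have h : Complex.exp (Complex.I * (β + 2 * Real.pi : ℝ)) = Complex.exp (Complex.I * β) := by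
    rw [← Complex.exp_periodic (Complex.I * β)]; push_cast; congr 1; ring
  rw [Complex.exp_neg, Complex.exp_neg, h]

theorem continuous_outputState (G : SimpleGraph V) (b : V → Fin 2) (θ : ℝ) :
    Continuous fun x : ℝ × ℝ => outputState G b θ x.1 x.2 := by
  simp only [outputState, U_alignedMixer, U_costHamiltonian]
  refine Continuous.matrix_mulVec ?_ (Continuous.matrix_mulVec ?_ continuous_const)
  · refine continuous_matrix fun x y => ?_
    simp only [tensorOp_apply]
    exact continuous_finsetProd _ fun j _ =>
      ((continuous_qubitMixer θ (b j)).matrix_elem _ _).comp continuous_snd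
  · exact Continuous.matrix_diagonal (by fun_prop)

/-- The cost Hamiltonian has integer eigenvalues, the cut values. -/
theorem outputState_periodic_left (G : SimpleGraph V) (b : V → Fin 2) (θ γ β : ℝ) :
    outputState G b θ (γ + 2 * Real.pi) β = outputState G b θ γ β := by
  simp only [outputState, U_costHamiltonian]
  congr 4; ext x
  rw [← (Complex.exp_periodic.nat_mul (cut G x)).sub_eq (-(Complex.I * γ) * (cut G x : ℂ))]
  push_cast; congr 1; ring

theorem outputState_periodic_right (G : SimpleGraph V) (b : V → Fin 2) (θ γ β : ℝ) :
    outputState G b θ γ (β + 2 * Real.pi) = outputState G b θ γ β := by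
  simp only [outputState, U_alignedMixer, qubitMixer_periodic]

theorem continuous_expectation (M : Op V) : Continuous (expectation M) := by
  unfold expectation
  fun_prop

theorem expectedCut_eq_sum (G : SimpleGraph V) (b : V → Fin 2) (θ γ β : ℝ) :
    expectedCut G b θ γ β = ∑ e ∈ edges G, edgeCutProb G b e θ γ β := by
  simp only [expectedCut, edgeCutProb, expectation, costHamiltonian, Matrix.sum_mulVec,
    dotProduct_sum, Complex.re_sum]

theorem edgeCutProb_nonneg (G : SimpleGraph V) (b : V → Fin 2) (e : Sym2 V) (θ γ β : ℝ) :
    0 ≤ edgeCutProb G b e θ γ β := by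
  rw [edgeCutProb, expectation, dotProduct, Complex.re_sum]
  refine Finset.sum_nonneg fun x _ => ?_
  rw [edgeCost, Matrix.mulVec_diagonal]
  split_ifs
  · simp [← Complex.normSq_eq_conj_mul_self, Complex.normSq_nonneg]
  · simp

end Circuit

/-! ### Sums over the edges near a vertex or an edge -/

section EdgeSums

variable {V : Type*}

theorem isCut_mk {b : V → Fin 2} {u v : V} : IsCut b s(u, v) ↔ b u ≠ b v := by
  simp [IsCut]

variable [Fintype V]

theorem mem_edges {G : SimpleGraph V} {e : Sym2 V} : e ∈ edges G ↔ e ∈ G.edgeSet := by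
  simp [edges]

open Classical in
theorem sum_edges_mem {R : Type*} [AddCommMonoid R] (G : SimpleGraph V) (u : V)
    [DecidablePred fun e : Sym2 V => u ∈ e] (h : Sym2 V → R) :
    ∑ e ∈ edges G with u ∈ e, h e = ∑ w, if G.Adj u w then h s(u, w) else 0 := by
  rw [← Finset.sum_filter]
  symm
  refine Finset.sum_bij (fun w _ => s(u, w)) ?_ ?_ ?_ ?_
  · intro w hw
    simpa [mem_edges] using hw
  · intro w _ w' _ h
    exact Sym2.congr_right.1 h
  · intro e he
    obtain ⟨he, w, rfl⟩ := Finset.mem_filter.1 he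
    exact ⟨w, by simpa [mem_edges] using he, rfl⟩
  · intros; rfl

open Classical in
/-- A sum over the edges whose terms vanish away from `u` and `v`. -/
theorem sum_edges_of_adj [DecidableEq V] {R : Type*} [AddCommMonoid R] (G : SimpleGraph V) {u v : V}
    (huv : G.Adj u v) (h : Sym2 V → R) (h0 : ∀ e, u ∉ e → v ∉ e → h e = 0) :
    ∑ e ∈ edges G, h e = h s(u, v) + ∑ w ∈ (Finset.univ.erase u).erase v,
      ((if G.Adj u w then h s(u, w) else 0) + (if G.Adj v w then h s(v, w) else 0)) := by
  have hne := huv.ne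
  have h1 : ∑ e ∈ edges G with u ∈ e, h e = h s(u, v) +
      ∑ w ∈ (Finset.univ.erase u).erase v, if G.Adj u w then h s(u, w) else 0 := by
    rw [sum_edges_mem, ← Finset.add_sum_erase _ _ (Finset.mem_univ u),
      ← Finset.add_sum_erase _ _ (Finset.mem_erase.2 ⟨hne.symm, Finset.mem_univ v⟩)]
    simp [huv]
  have h2 : ∑ e ∈ edges G with ¬ u ∈ e, h e =
      ∑ w ∈ (Finset.univ.erase u).erase v, if G.Adj v w then h s(v, w) else 0 := by
    -- Away from `u` only edges at `v` contribute; zeroing those that contain `u` keeps `uv` from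
    -- being counted twice.
    have h3 : ∑ e ∈ edges G with ¬ u ∈ e, h e =
        ∑ e ∈ edges G with v ∈ e, if u ∈ e then 0 else h e := by
      rw [Finset.sum_filter, Finset.sum_filter]
      refine Finset.sum_congr rfl fun e _ => ?_
      by_cases hu : u ∈ e <;> by_cases hv : v ∈ e <;> simp [hu, hv, h0 e]
    rw [h3, sum_edges_mem, ← Finset.add_sum_erase _ _ (Finset.mem_univ u),
      ← Finset.add_sum_erase _ _ (Finset.mem_erase.2 ⟨hne.symm, Finset.mem_univ v⟩)]
    simp only [Sym2.mem_iff, or_true, if_true, ite_self, G.irrefl, if_false, zero_add]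
    refine Finset.sum_congr rfl fun w hw => ?_
    have : w ≠ u := (Finset.mem_erase.1 (Finset.mem_erase.1 hw).2).1
    simp [hne, this.symm]
  rw [← Finset.sum_filter_add_sum_filter_not (edges G) (fun e => u ∈ e), h1, h2, add_assoc,
    ← Finset.sum_add_distrib]

open Classical in
theorem cut_eq_sum {R : Type*} [AddCommMonoidWithOne R] (G : SimpleGraph V) (b : V → Fin 2) :
    (cut G b : R) = ∑ e ∈ edges G, if IsCut b e then 1 else 0 := by
  rw [cut, Finset.sum_boole]

end EdgeSums

/-! ### Locality of the cut probability of an edge -/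

section LightCone

variable {V : Type*} [Fintype V] [DecidableEq V]

/-- Indicator of two distinct bits. -/
def bitNe (a c : Fin 2) : ℂ := if a = c then 0 else 1

open Classical in
-- Edges that avoid `u` and `v` are cut by both strings or by neither and cancel. This difference is
-- the exponent of the relative phase between the basis states `x` and `y`.
theorem cut_sub_cut (G : SimpleGraph V) {u v : V} (huv : G.Adj u v) (x y : V → Fin 2)
    (hxy : ∀ w, w ≠ u → w ≠ v → x w = y w) :
    (cut G y : ℂ) - cut G x = bitNe (y u) (y v) - bitNe (x u) (x v) +
      ∑ w ∈ (Finset.univ.erase u).erase v,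
        ((if G.Adj u w then bitNe (y u) (x w) - bitNe (x u) (x w) else 0) +
          (if G.Adj v w then bitNe (y v) (x w) - bitNe (x v) (x w) else 0)) := by
  rw [cut_eq_sum, cut_eq_sum, ← Finset.sum_sub_distrib, sum_edges_of_adj G huv]
  · congr 1
    · simp [isCut_mk, bitNe]
    · refine Finset.sum_congr rfl fun w hw => ?_
      simp only [Finset.mem_erase, Finset.mem_univ, and_true] at hw
      simp [isCut_mk, bitNe, hxy w hw.2 hw.1]
  · intro e
    induction e using Sym2.ind with
    | _ a c =>
      intro hu hv
      simp only [Sym2.mem_iff, not_or] at hu hv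
      simp [isCut_mk, hxy a (Ne.symm hu.1) (Ne.symm hv.1), hxy c (Ne.symm hu.2) (Ne.symm hv.2)]

/-- The observable `Z` of one qubit, conjugated by the mixer. -/
def mixedZ (θ β : ℝ) (a : Fin 2) : Matrix (Fin 2) (Fin 2) ℂ :=
  (qubitMixer θ β a)ᴴ * pauliZ * qubitMixer θ β a

/-- The state before the mixer. -/
def phasedState (G : SimpleGraph V) (b : V → Fin 2) (θ γ : ℝ) : (V → Fin 2) → ℂ :=
  U (costHamiltonian G) γ *ᵥ warmStart θ b

theorem phasedState_apply (G : SimpleGraph V) (b : V → Fin 2) (θ γ : ℝ) (x : V → Fin 2) :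
    phasedState G b θ γ x =
      Complex.exp (-(Complex.I * γ) * (cut G x : ℂ)) * ∏ j, qubitState θ (b j) (x j) := by
  rw [phasedState, U_costHamiltonian, Matrix.mulVec_diagonal, warmStart]

theorem star_qubitState (θ : ℝ) (a c : Fin 2) :
    star (qubitState θ a c) = qubitState θ a c := by
  fin_cases a <;> fin_cases c <;>
    simp [qubitState, -Complex.ofReal_cos, -Complex.ofReal_sin, Complex.conj_ofReal]

theorem star_exp_phase (γ : ℝ) (n : ℕ) :
    star (Complex.exp (-(Complex.I * γ) * (n : ℂ))) =
      Complex.exp (-(Complex.I * γ) * (-(n : ℂ))) := by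
  rw [Complex.star_def, ← Complex.exp_conj]
  simp

theorem sum_prod_apply {κ R : Type*} [Fintype κ] [CommSemiring R] (f : V → κ → R) :
    ∑ x : V → κ, ∏ j, f j (x j) = ∏ j, ∑ z, f j z := by
  rw [Finset.prod_univ_sum, Fintype.piFinset_univ]

theorem phasedState_norm (G : SimpleGraph V) (b : V → Fin 2) (θ γ : ℝ) :
    star (phasedState G b θ γ) ⬝ᵥ phasedState G b θ γ = 1 := by
  have h : ∀ x, star (phasedState G b θ γ) x * phasedState G b θ γ x =
      ∏ j, qubitState θ (b j) (x j) * qubitState θ (b j) (x j) := by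
    intro x
    rw [Pi.star_apply, phasedState_apply, star_mul', star_exp_phase, star_prod,
      Finset.prod_mul_distrib]
    simp only [star_qubitState]
    rw [mul_mul_mul_comm, ← Complex.exp_add]
    simp
  rw [dotProduct, Finset.sum_congr rfl fun x _ => h x,
    sum_prod_apply fun j z => qubitState θ (b j) z * qubitState θ (b j) z]
  simp [Fin.sum_univ_two, qubitState_sq_add_sq]

/-- The mixer is a tensor product of unitaries; moved onto the observable, it cancels on every qubit
except `u` and `v`. -/
theorem edgeCutProb_eq_expectation (G : SimpleGraph V) (b : V → Fin 2) {u v : V} (huv : u ≠ v)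
    (θ γ β : ℝ) :
    edgeCutProb G b s(u, v) θ γ β = (1 / 2 * (1 - star (phasedState G b θ γ) ⬝ᵥ
      (tensorOp (fun j => if j = u ∨ j = v then mixedZ θ β (b j) else 1) *ᵥ
        phasedState G b θ γ)) : ℂ).re := by
  set T := tensorOp (fun j => qubitMixer θ β (b j)) with hT
  have hZZ : onQubit u pauliZ * onQubit v pauliZ =
      tensorOp (fun j => if j = u ∨ j = v then pauliZ else 1) := by
    rw [onQubit_eq_tensorOp, onQubit_eq_tensorOp, tensorOp_mul]
    congr 1; ext1 j
    by_cases h1 : j = u <;> by_cases h2 : j = v <;> simp_all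
  have hTT : Tᴴ * T = 1 := by
    rw [hT, tensorOp_conjTranspose, tensorOp_mul]
    simp [qubitMixer_conjTranspose_mul, tensorOp_one]
  have hTZT : Tᴴ * (onQubit u pauliZ * onQubit v pauliZ) * T =
      tensorOp (fun j => if j = u ∨ j = v then mixedZ θ β (b j) else 1) := by
    rw [hZZ, hT, tensorOp_conjTranspose, tensorOp_mul, tensorOp_mul]
    congr 1; ext1 j
    split_ifs
    · rfl
    · simp [qubitMixer_conjTranspose_mul]
  have hC : Tᴴ * edgeCost s(u, v) * T = (1 / 2 : ℂ) • (1 -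
      tensorOp (fun j => if j = u ∨ j = v then mixedZ θ β (b j) else 1)) := by
    rw [edgeCost_eq_pauli, ← hTZT]
    simp [mul_sub, sub_mul, hTT]
  have hout : outputState G b θ γ β = T *ᵥ phasedState G b θ γ := by
    rw [outputState, U_alignedMixer, phasedState]
  rw [edgeCutProb, expectation, hout, Matrix.star_mulVec, ← Matrix.dotProduct_mulVec,
    Matrix.mulVec_mulVec, Matrix.mulVec_mulVec, hC, Matrix.smul_mulVec, dotProduct_smul,
    Matrix.sub_mulVec, Matrix.one_mulVec, dotProduct_sub, phasedState_norm, smul_eq_mul]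

/-- The bits of the central qubits before and after the observable is applied. -/
abbrev PairBits := (Fin 2 × Fin 2) × (Fin 2 × Fin 2)

/-- The contribution of the two endpoints of an edge to the expectation of `Z Z`. -/
def pairWeight (θ γ β : ℝ) (a a' : Fin 2) (c : PairBits) : ℂ :=
  Complex.exp (-(Complex.I * γ) * (bitNe c.1.2 c.2.2 - bitNe c.1.1 c.2.1)) *
    (qubitState θ a c.1.1 * mixedZ θ β a c.1.1 c.1.2 * qubitState θ a c.1.2) *
    (qubitState θ a' c.2.1 * mixedZ θ β a' c.2.1 c.2.2 * qubitState θ a' c.2.2)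

open Classical in
/-- The phase that a qubit in the state `z` acquires from the two endpoints of an edge. -/
def neighborPhase (γ : ℝ) (c : PairBits) (adj adj' : Prop) (z : Fin 2) : ℂ :=
  Complex.exp (-(Complex.I * γ) *
    ((if adj then bitNe c.1.2 z - bitNe c.1.1 z else 0) +
      (if adj' then bitNe c.2.2 z - bitNe c.2.1 z else 0)))

/-- The contribution of another qubit with bit `a` to the expectation of `Z Z`. -/
def neighborFactor (θ γ : ℝ) (c : PairBits) (adj adj' : Prop) (a : Fin 2) : ℂ :=
  ∑ z, qubitState θ a z * qubitState θ a z * neighborPhase γ c adj adj' z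

theorem neighborFactor_of_not (θ γ : ℝ) (c : PairBits) {adj adj' : Prop} (h : ¬ adj)
    (h' : ¬ adj') (a : Fin 2) : neighborFactor θ γ c adj adj' a = 1 := by
  simp [neighborFactor, neighborPhase, h, h', Fin.sum_univ_two, qubitState_sq_add_sq]

/-- The single-qubit factors of the expectation of `Z Z` for fixed bits of the central qubits. -/
def siteFactor (G : SimpleGraph V) (b : V → Fin 2) (u v : V) (θ γ β : ℝ) (c : PairBits) (j : V)
    (z : Fin 2 × Fin 2) : ℂ :=
  if j = u then
    if z = c.1 then Complex.exp (-(Complex.I * γ) * (bitNe c.1.2 c.2.2 - bitNe c.1.1 c.2.1)) *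
      (qubitState θ (b u) c.1.1 * mixedZ θ β (b u) c.1.1 c.1.2 * qubitState θ (b u) c.1.2) else 0
  else if j = v then
    if z = c.2 then
      qubitState θ (b v) c.2.1 * mixedZ θ β (b v) c.2.1 c.2.2 * qubitState θ (b v) c.2.2 else 0
  else
    if z.1 = z.2 then qubitState θ (b j) z.1 * qubitState θ (b j) z.1 *
      neighborPhase γ c (G.Adj u j) (G.Adj v j) z.1 else 0

theorem prod_eq_mul_mul {M : Type*} [CommMonoid M] {u v : V} (huv : u ≠ v) (g : V → M) :
    ∏ j, g j = g u * g v * ∏ w ∈ (Finset.univ.erase u).erase v, g w := by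
  rw [← Finset.mul_prod_erase _ _ (Finset.mem_univ u),
    ← Finset.mul_prod_erase _ _ (Finset.mem_erase.2 ⟨huv.symm, Finset.mem_univ v⟩), mul_assoc]

/-- Once the bits of `u` and `v` on both sides are fixed, a term of the double sum over basis states
is a product over qubits: the remaining phase couples each other qubit to `u` and `v` only. The
phase of the edge `uv` itself is stored in the factor at `u`. The sum over `c` introduces these
fixed bits. -/
theorem prod_siteFactor (G : SimpleGraph V) (b : V → Fin 2) {u v : V} (huv : G.Adj u v)
    (θ γ β : ℝ) (x y : V → Fin 2) :
    star (phasedState G b θ γ) x *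
      (tensorOp (fun j => if j = u ∨ j = v then mixedZ θ β (b j) else 1) x y *
        phasedState G b θ γ y) =
      ∑ c : PairBits, ∏ j, siteFactor G b u v θ γ β c j (x j, y j) := by
  have hne := huv.ne
  -- Only the `c` that records the bits of `x` and `y` at `u` and `v` survives; for any other, the
  -- factor at `u` or at `v` vanishes.
  rw [Finset.sum_eq_single ((x u, y u), (x v, y v))]
  · rw [Pi.star_apply, phasedState_apply, phasedState_apply, star_mul', star_exp_phase, star_prod,
      tensorOp_apply]
    simp only [star_qubitState]
    by_cases hxy : ∀ w, w ≠ u → w ≠ v → x w = y w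
    · have hphase : Complex.exp (-(Complex.I * γ) * (-(cut G x : ℂ))) *
          Complex.exp (-(Complex.I * γ) * (cut G y : ℂ)) =
          Complex.exp (-(Complex.I * γ) * (bitNe (y u) (y v) - bitNe (x u) (x v))) *
          ∏ w ∈ (Finset.univ.erase u).erase v,
            neighborPhase γ ((x u, y u), (x v, y v)) (G.Adj u w) (G.Adj v w) (x w) := by
        simp only [neighborPhase]
        rw [← Complex.exp_add, ← Complex.exp_sum, ← Complex.exp_add, ← Finset.mul_sum]
        congr 1
        linear_combination (-(Complex.I * γ)) * cut_sub_cut G huv x y hxy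
      rw [prod_eq_mul_mul hne (fun j => siteFactor G b u v θ γ β _ j (x j, y j)),
        prod_eq_mul_mul hne (fun j => qubitState θ (b j) (x j)),
        prod_eq_mul_mul hne (fun j => qubitState θ (b j) (y j)), prod_eq_mul_mul hne]
      have h1 : ∏ w ∈ (Finset.univ.erase u).erase v,
          (if w = u ∨ w = v then mixedZ θ β (b w) else 1) (x w) (y w) = 1 := by
        refine Finset.prod_eq_one fun w hw => ?_
        simp only [Finset.mem_erase, Finset.mem_univ, and_true] at hw
        rw [if_neg (by tauto), hxy w hw.2 hw.1, Matrix.one_apply_eq]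
      have h2 : ∏ w ∈ (Finset.univ.erase u).erase v,
          siteFactor G b u v θ γ β ((x u, y u), (x v, y v)) w (x w, y w) =
          (∏ w ∈ (Finset.univ.erase u).erase v, qubitState θ (b w) (x w)) *
          (∏ w ∈ (Finset.univ.erase u).erase v, qubitState θ (b w) (y w)) *
          ∏ w ∈ (Finset.univ.erase u).erase v,
            neighborPhase γ ((x u, y u), (x v, y v)) (G.Adj u w) (G.Adj v w) (x w) := by
        rw [← Finset.prod_mul_distrib, ← Finset.prod_mul_distrib]
        refine Finset.prod_congr rfl fun w hw => ?_
        simp only [Finset.mem_erase, Finset.mem_univ, and_true] at hw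
        simp [siteFactor, hw.1, hw.2, hxy w hw.2 hw.1]
      rw [h1, h2]
      simp only [siteFactor, hne.symm, if_true, true_or, or_true, if_false]
      linear_combination (qubitState θ (b u) (x u) * qubitState θ (b v) (x v) *
        (∏ w ∈ (Finset.univ.erase u).erase v, qubitState θ (b w) (x w)) *
        (mixedZ θ β (b u) (x u) (y u) * mixedZ θ β (b v) (x v) (y v)) *
        (qubitState θ (b u) (y u) * qubitState θ (b v) (y v) *
        ∏ w ∈ (Finset.univ.erase u).erase v, qubitState θ (b w) (y w))) * hphase
    -- The observable is the identity on `w`, so both sides vanish when `x` and `y` differ there.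
    · push Not at hxy
      obtain ⟨w, hwu, hwv, hw⟩ := hxy
      have h1 : siteFactor G b u v θ γ β ((x u, y u), (x v, y v)) w (x w, y w) = 0 := by
        simp [siteFactor, hwu, hwv, hw]
      have h2 : (if w = u ∨ w = v then mixedZ θ β (b w) else 1) (x w) (y w) = 0 := by
        rw [if_neg (by tauto), Matrix.one_apply_ne hw]
      rw [Finset.prod_eq_zero (f := fun j => siteFactor G b u v θ γ β _ j (x j, y j))
        (Finset.mem_univ w) h1, Finset.prod_eq_zero (f := fun j =>
        (if j = u ∨ j = v then mixedZ θ β (b j) else 1) (x j) (y j)) (Finset.mem_univ w) h2]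
      simp
  · intro c _ hc
    by_cases hu : (x u, y u) = c.1
    · refine Finset.prod_eq_zero (Finset.mem_univ v) ?_
      have hv : (x v, y v) ≠ c.2 := fun hv => hc (Prod.ext hu.symm hv.symm)
      simp [siteFactor, hne.symm, hv]
    · refine Finset.prod_eq_zero (Finset.mem_univ u) ?_
      simp [siteFactor, hu]
  · simp

/-- Pairs of bitstrings are the same as families of pairs of bits, so the sum of products becomes a
product of single-site sums. -/
theorem sum_siteFactor (G : SimpleGraph V) (b : V → Fin 2) {u v : V} (huv : u ≠ v)
    (θ γ β : ℝ) (c : PairBits) :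
    ∑ x : V → Fin 2, ∑ y : V → Fin 2, ∏ j, siteFactor G b u v θ γ β c j (x j, y j) =
      pairWeight θ γ β (b u) (b v) c * ∏ w ∈ (Finset.univ.erase u).erase v,
        neighborFactor θ γ c (G.Adj u w) (G.Adj v w) (b w) := by
  have h : ∑ x : V → Fin 2, ∑ y : V → Fin 2, ∏ j, siteFactor G b u v θ γ β c j (x j, y j) =
      ∏ j, ∑ z, siteFactor G b u v θ γ β c j z := by
    rw [← sum_prod_apply, ← Fintype.sum_prod_type']
    exact (Fintype.sum_equiv (Equiv.arrowProdEquivProdArrow V (fun _ => Fin 2) (fun _ => Fin 2)) _ _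
      fun _ => rfl).symm
  rw [h, prod_eq_mul_mul huv]
  congr 1
  · simp [siteFactor, huv.symm, pairWeight]
  · refine Finset.prod_congr rfl fun w hw => ?_
    simp only [Finset.mem_erase, Finset.mem_univ, and_true] at hw
    simp [siteFactor, hw.1, hw.2, neighborFactor, Fintype.sum_prod_type]

/-- Everything on the right refers to the colors and to adjacency with `u` or `v`; edges between
other vertices have disappeared. -/
theorem edgeCutProb_formula (G : SimpleGraph V) (b : V → Fin 2) {u v : V} (huv : G.Adj u v)
    (θ γ β : ℝ) :
    edgeCutProb G b s(u, v) θ γ β = (1 / 2 * (1 - ∑ c, pairWeight θ γ β (b u) (b v) c *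
      ∏ w ∈ (Finset.univ.erase u).erase v,
        neighborFactor θ γ c (G.Adj u w) (G.Adj v w) (b w)) : ℂ).re := by
  rw [edgeCutProb_eq_expectation G b huv.ne]
  congr 3
  simp only [dotProduct, Matrix.mulVec, Finset.mul_sum, prod_siteFactor G b huv]
  rw [← Finset.sum_congr rfl fun c _ => sum_siteFactor G b huv.ne θ γ β c,
    Finset.sum_congr rfl fun x _ => Finset.sum_comm, Finset.sum_comm]

/-- The probability that an edge is cut depends only on the colored graph formed by the edges that
meet it. -/
theorem edgeCutProb_eq_of_embedding {W : Type*} [Fintype W] [DecidableEq W]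
    (G : SimpleGraph V) (H : SimpleGraph W) (b : V → Fin 2) (c : W → Fin 2) (φ : W → V)
    (hφ : Function.Injective φ) {u v : W} (huv : H.Adj u v)
    (hu : ∀ w, G.Adj (φ u) (φ w) ↔ H.Adj u w) (hv : ∀ w, G.Adj (φ v) (φ w) ↔ H.Adj v w)
    (hru : ∀ x, G.Adj (φ u) x → x ∈ Set.range φ) (hrv : ∀ x, G.Adj (φ v) x → x ∈ Set.range φ)
    (hb : ∀ w, b (φ w) = c w) (θ γ β : ℝ) :
    edgeCutProb G b s(φ u, φ v) θ γ β = edgeCutProb H c s(u, v) θ γ β := by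
  rw [edgeCutProb_formula G b ((hu v).2 huv), edgeCutProb_formula H c huv, hb, hb]
  congr 3
  refine Finset.sum_congr rfl fun p _ => ?_
  congr 1
  have hsub : ((Finset.univ.erase u).erase v).map ⟨φ, hφ⟩ ⊆
      (Finset.univ.erase (φ u)).erase (φ v) := by
    intro x hx
    obtain ⟨w, hw, rfl⟩ := Finset.mem_map.1 hx
    simp only [Finset.mem_erase, Finset.mem_univ, and_true] at hw
    simpa [hφ.eq_iff] using hw
  -- Qubits outside the image of `φ` are adjacent to neither endpoint and contribute the factor 1.
  rw [← Finset.prod_subset hsub, Finset.prod_map]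
  · simp [hu, hv, hb]
  · intro x hx hx'
    refine neighborFactor_of_not _ _ _ (fun h => ?_) (fun h => ?_) _
    on_goal 1 => obtain ⟨w, rfl⟩ := hru x h
    on_goal 2 => obtain ⟨w, rfl⟩ := hrv x h
    all_goals
      simp only [Finset.mem_erase, Finset.mem_univ, and_true, ne_eq, hφ.eq_iff] at hx
      exact hx' (Finset.mem_map.2 ⟨w, by simp [hx], rfl⟩)

end LightCone

/-! ### Maxima of doubly periodic functions -/

section Periodic

/-- Periodicity in both variational parameters. -/
def IsBiperiodic (f : ℝ × ℝ → ℝ) : Prop :=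
  ∀ γ β : ℝ, f (γ + 2 * Real.pi, β) = f (γ, β) ∧ f (γ, β + 2 * Real.pi) = f (γ, β)

/-- A fundamental domain for the variational parameters. -/
def angleSquare : Set (ℝ × ℝ) := Set.Icc 0 (2 * Real.pi) ×ˢ Set.Icc 0 (2 * Real.pi)

theorem isCompact_angleSquare : IsCompact angleSquare := isCompact_Icc.prod isCompact_Icc

theorem IsBiperiodic.range_eq {f : ℝ × ℝ → ℝ} (hf : IsBiperiodic f) :
    Set.range f = f '' angleSquare := by
  refine Set.Subset.antisymm ?_ (Set.image_subset_range _ _)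
  rintro _ ⟨⟨γ, β⟩, rfl⟩
  have h1 : Function.Periodic (fun γ => f (γ, β)) (2 * Real.pi) := fun γ => (hf γ β).1
  obtain ⟨γ', hγ', h⟩ := h1.exists_mem_Ico₀ Real.two_pi_pos γ
  have h2 : Function.Periodic (fun β => f (γ', β)) (2 * Real.pi) := fun β => (hf γ' β).2
  obtain ⟨β', hβ', h'⟩ := h2.exists_mem_Ico₀ Real.two_pi_pos β
  exact ⟨(γ', β'), ⟨Set.Ico_subset_Icc_self hγ', Set.Ico_subset_Icc_self hβ'⟩,
    (h.trans h').symm⟩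

theorem IsBiperiodic.isGreatest_iSup {f : ℝ × ℝ → ℝ} (hf : IsBiperiodic f) (hc : Continuous f) :
    IsGreatest (Set.range f) (⨆ x, f x) := by
  have hcomp : IsCompact (Set.range f) := hf.range_eq ▸ isCompact_angleSquare.image hc
  exact hcomp.isGreatest_sSup (Set.range_nonempty f)

end Periodic

/-! ### Attainment of the optimal expected cut -/

section Circuit

variable {V : Type*} [Fintype V] [DecidableEq V]

theorem continuous_edgeCutProb (G : SimpleGraph V) (b : V → Fin 2) (e : Sym2 V) (θ : ℝ) :
    Continuous fun x : ℝ × ℝ => edgeCutProb G b e θ x.1 x.2 :=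
  (continuous_expectation _).comp (continuous_outputState G b θ)

theorem isGreatest_optExpectedCut (G : SimpleGraph V) (b : V → Fin 2) (θ : ℝ) :
    IsGreatest (Set.range fun x : ℝ × ℝ => expectedCut G b θ x.1 x.2) (optExpectedCut G b θ) := by
  refine IsBiperiodic.isGreatest_iSup (fun γ β => ?_)
    ((continuous_expectation _).comp (continuous_outputState G b θ))
  simp only [expectedCut, outputState_periodic_left, outputState_periodic_right, and_self]

end Circuit

/-! ### The optimization problems: compactness, attained extrema, max-min inequality -/

section Objective

/-- The linear form `F` with arbitrary values for the 15 colored edge neighborhoods. -/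
def linearForm (p : Params) (a : Fin 3 → ℝ) (b c : Fin 6 → ℝ) : ℝ :=
  (p.2.1 1 + p.2.1 5 + p.2.1 2) * a 0 + p.2.1 3 * a 1 + (p.2.1 0 + p.2.1 4 + p.2.1 6) * a 2
    + (p.2.2 0 + p.2.2 1 + p.2.1 3) * b 0
    + (2 * p.2.2 2 + 4 * p.2.1 0 + 2 * p.2.1 4) * b 1
    + (2 * p.2.2 0 + 4 * p.2.1 1 + 2 * p.2.1 2 + p.2.1 3) * b 2
    + (2 * p.2.2 3 + p.2.1 3 + 2 * p.2.1 4 + 4 * p.2.1 6) * b 3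
    + (2 * p.2.2 1 + 2 * p.2.1 2 + 4 * p.2.1 5) * b 4
    + (p.2.2 2 + p.2.2 3 + p.2.1 3) * b 5
    + ∑ i, p.1 i * c i

theorem F_eq_linearForm (p : Params) (θ γ β : ℝ) :
    F p θ γ β = linearForm p (f4 · θ γ β) (f5 · θ γ β) (f6 · θ γ β) := by
  simp only [F, linearForm]

theorem continuous_linearForm :
    Continuous fun q : Params × (Fin 3 → ℝ) × (Fin 6 → ℝ) × (Fin 6 → ℝ) =>
      linearForm q.1 q.2.1 q.2.2.1 q.2.2.2 := by
  unfold linearForm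
  fun_prop

theorem continuous_F {X : Type*} [TopologicalSpace X] (θ : ℝ) {p : X → Params} {y : X → ℝ × ℝ}
    (hp : Continuous p) (hy : Continuous y) :
    Continuous fun x => F (p x) θ (y x).1 (y x).2 := by
  have h4 : Continuous fun x i => f4 i θ (y x).1 (y x).2 := continuous_pi fun i =>
    (continuous_edgeCutProb g4 (color4 i) s(0, 1) θ).comp hy
  have h5 : Continuous fun x i => f5 i θ (y x).1 (y x).2 := continuous_pi fun i =>
    (continuous_edgeCutProb g5 (color5 i) s(0, 1) θ).comp hy
  have h6 : Continuous fun x i => f6 i θ (y x).1 (y x).2 := continuous_pi fun i =>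
    (continuous_edgeCutProb g6 (color6 i) s(0, 1) θ).comp hy
  simp only [F_eq_linearForm]
  have h := continuous_linearForm.comp (hp.prodMk (h4.prodMk (h5.prodMk h6)))
  exact h

theorem F_isBiperiodic (θ : ℝ) (p : Params) : IsBiperiodic fun x => F p θ x.1 x.2 := by
  intro γ β
  simp only [F, f4, f5, f6, edgeCutProb, outputState_periodic_left, outputState_periodic_right,
    and_self]

theorem isGreatest_M (θ : ℝ) (p : Params) :
    IsGreatest (Set.range fun x : ℝ × ℝ => F p θ x.1 x.2) (M θ p) :=
  (F_isBiperiodic θ p).isGreatest_iSup (continuous_F θ continuous_const continuous_id)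

theorem F_le_M (θ : ℝ) (p : Params) (x : ℝ × ℝ) : F p θ x.1 x.2 ≤ M θ p :=
  (isGreatest_M θ p).2 ⟨x, rfl⟩

theorem continuous_M (θ : ℝ) : Continuous (M θ) := by
  have h : M θ = fun p => sSup ((fun x : ℝ × ℝ => F p θ x.1 x.2) '' angleSquare) := by
    ext p
    rw [← (F_isBiperiodic θ p).range_eq]
    rfl
  rw [h]
  exact isCompact_angleSquare.continuous_sSup (continuous_F θ continuous_fst continuous_snd)

theorem continuous_denom : Continuous denom := by
  unfold denom
  fun_prop

/-- From `4s + 3t ≤ 2/3` and `s ≥ 0` follows `s + t ≤ 2/9`. -/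
theorem denom_pos {κ : ℝ} {p : Params} (hp : p ∈ P κ) : 0 < denom p := by
  obtain ⟨-, hs, -, -, h, -⟩ := hp
  have := Finset.sum_nonneg fun i (_ : i ∈ Finset.univ) => hs i
  unfold denom
  linarith

/-- The equation `5s + 3t + r = 1` with nonnegative entries confines every coordinate to `[0, 1]`.
-/
theorem isCompact_P (κ : ℝ) : IsCompact (P κ) := by
  refine IsCompact.of_isClosed_subset (isCompact_Icc (a := (0 : Params)) (b := 1)) ?_ ?_
  · unfold P
    simp only [Set.ofPred_and, Set.ofPred_forall]
    refine IsClosed.inter (isClosed_iInter fun i => isClosed_le (by fun_prop) (by fun_prop)) ?_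
    refine IsClosed.inter (isClosed_iInter fun i => isClosed_le (by fun_prop) (by fun_prop)) ?_
    refine IsClosed.inter (isClosed_iInter fun i => isClosed_le (by fun_prop) (by fun_prop)) ?_
    refine IsClosed.inter (isClosed_eq (by fun_prop) (by fun_prop)) ?_
    refine IsClosed.inter (isClosed_le (by fun_prop) (by fun_prop)) ?_
    refine IsClosed.inter (isClosed_le (by fun_prop) (by fun_prop)) ?_
    exact IsClosed.inter (isClosed_le (by fun_prop) (by fun_prop))
      (isClosed_le (by fun_prop) (by fun_prop))
  · rintro ⟨r, s, t⟩ ⟨hr, hs, ht, h, -⟩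
    have hr' := Finset.sum_nonneg fun i (_ : i ∈ Finset.univ) => hr i
    have hs' := Finset.sum_nonneg fun i (_ : i ∈ Finset.univ) => hs i
    have ht' := Finset.sum_nonneg fun i (_ : i ∈ Finset.univ) => ht i
    have hr1 := fun i => Finset.single_le_sum (fun i _ => hr i) (Finset.mem_univ i)
    have hs1 := fun i => Finset.single_le_sum (fun i _ => hs i) (Finset.mem_univ i)
    have ht1 := fun i => Finset.single_le_sum (fun i _ => ht i) (Finset.mem_univ i)
    refine ⟨⟨hr, hs, ht⟩, fun i => ?_, fun i => ?_, fun i => ?_⟩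
    · have := hr1 i; simp only [Prod.fst_one, Pi.one_apply] at *; linarith
    · have := hs1 i; simp only [Prod.fst_one, Prod.snd_one, Pi.one_apply] at *; linarith
    · have := ht1 i; simp only [Prod.snd_one, Pi.one_apply] at *; linarith

theorem isCompact_P' (κ : ℝ) : IsCompact (P' κ) := by
  refine IsCompact.of_isClosed_subset (isCompact_Icc (a := (0 : Fin 6 → ℝ)) (b := 1)) ?_ ?_
  · unfold P'
    simp only [Set.ofPred_and, Set.ofPred_forall]
    refine IsClosed.inter (isClosed_iInter fun i => isClosed_le (by fun_prop) (by fun_prop)) ?_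
    refine IsClosed.inter (isClosed_eq (by fun_prop) (by fun_prop)) ?_
    refine IsClosed.inter (isClosed_le (by fun_prop) (by fun_prop)) ?_
    exact IsClosed.inter (isClosed_le (by fun_prop) (by fun_prop))
      (isClosed_le (by fun_prop) (by fun_prop))
  · rintro r ⟨hr, h, -⟩
    refine ⟨hr, fun i => ?_⟩
    rw [Pi.one_apply, ← h]
    exact Finset.single_le_sum (fun j _ => hr j) (Finset.mem_univ i)

theorem P'_nonempty {κ : ℝ} (hκ : κ ≤ 1) : (P' κ).Nonempty := by
  -- All weight goes to `g_{6,2}`, whose central edge is cut, so `r₁ = r₆ = 0` and the constraint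
  -- involving `κ` reduces to `κ ≤ 1`.
  refine ⟨Pi.single 1 1, fun i => ?_, ?_⟩
  · by_cases h : i = 1
    · subst h; simp
    · simp [h]
  · simp [hκ]

theorem mk_zero_mem_P_iff {κ : ℝ} {r : Fin 6 → ℝ} : ((r, 0, 0) : Params) ∈ P κ ↔ r ∈ P' κ := by
  simp only [P, P', Set.mem_ofPred_eq, Pi.zero_apply, Finset.sum_const_zero, mul_zero, zero_add,
    le_refl, implies_true, true_and]
  norm_num

theorem P_nonempty {κ : ℝ} (hκ : κ ≤ 1) : (P κ).Nonempty :=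
  let ⟨r, hr⟩ := P'_nonempty hκ
  ⟨(r, 0, 0), mk_zero_mem_P_iff.2 hr⟩

theorem isLeast_minMax {κ : ℝ} (hκ : κ ≤ 1) (θ : ℝ) :
    IsLeast ((fun p => M θ p / denom p) '' P κ) (minMax κ θ) :=
  ((isCompact_P κ).image_of_continuousOn ((continuous_M θ).continuousOn.div
    continuous_denom.continuousOn fun _ hp => (denom_pos hp).ne')).isLeast_sInf
    ((P_nonempty hκ).image _)

theorem isLeast_innerMin {κ : ℝ} (hκ : κ ≤ 1) (θ : ℝ) (x : ℝ × ℝ) :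
    IsLeast ((fun p => F p θ x.1 x.2 / denom p) '' P κ) (innerMin κ θ x) :=
  ((isCompact_P κ).image_of_continuousOn ((continuous_F θ continuous_id continuous_const).continuousOn.div
    continuous_denom.continuousOn fun _ hp => (denom_pos hp).ne')).isLeast_sInf
    ((P_nonempty hκ).image _)

theorem isLeast_minMax' {κ : ℝ} (hκ : κ ≤ 1) (θ : ℝ) :
    IsLeast ((fun r => M θ (r, 0, 0)) '' P' κ) (minMax' κ θ) :=
  ((isCompact_P' κ).image ((continuous_M θ).comp (by fun_prop))).isLeast_sInf
    ((P'_nonempty hκ).image _)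

theorem isLeast_innerMin' {κ : ℝ} (hκ : κ ≤ 1) (θ : ℝ) (x : ℝ × ℝ) :
    IsLeast ((fun r => F (r, 0, 0) θ x.1 x.2) '' P' κ) (innerMin' κ θ x) :=
  ((isCompact_P' κ).image (continuous_F θ (p := fun r => (r, 0, 0))
    (by fun_prop) continuous_const)).isLeast_sInf
    ((P'_nonempty hκ).image _)

theorem isGreatest_LB (κ θ : ℝ) : IsGreatest (Set.range (innerMin κ θ)) (LB κ θ) := by
  refine IsBiperiodic.isGreatest_iSup (fun γ β => ?_) ?_
  · have h := fun p => F_isBiperiodic θ p γ β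
    simp only [innerMin, (h _).1, (h _).2, and_self]
  -- The quotient is continuous where the denominator is nonzero, which is known on the polytope, so
  -- the minimum is taken over the subtype.
  · have : CompactSpace (P κ) := isCompact_iff_compactSpace.1 (isCompact_P κ)
    have h := (isCompact_univ (X := P κ)).continuous_sInf
      (f := fun (x : ℝ × ℝ) (p : P κ) => F p.1 θ x.1 x.2 / denom p.1)
      (Continuous.div (continuous_F θ (continuous_subtype_val.comp continuous_snd) continuous_fst)
        (continuous_denom.comp (by fun_prop)) fun q => (denom_pos q.2.2).ne')
    convert h using 3 with x
    rw [innerMin, Set.image_univ, Set.image_eq_range]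

theorem isGreatest_LB' (κ θ : ℝ) : IsGreatest (Set.range (innerMin' κ θ)) (LB' κ θ) := by
  refine IsBiperiodic.isGreatest_iSup (fun γ β => ?_) ?_
  · have h := fun p => F_isBiperiodic θ p γ β
    simp only [innerMin', (h _).1, (h _).2, and_self]
  · exact (isCompact_P' κ).continuous_sInf
      (f := fun (x : ℝ × ℝ) (r : Fin 6 → ℝ) => F (r, 0, 0) θ x.1 x.2)
      (continuous_F θ (p := fun q : (ℝ × ℝ) × (Fin 6 → ℝ) => (q.2, 0, 0)) (by fun_prop)
        continuous_fst)

/-- Evaluate at the maximizing angles `x` and the minimizing point `p`: the inner minimum at `x` is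
at most the quotient at `(x, p)`, which is at most the one with `M` at `p`. -/
theorem LB_le_minMax {κ : ℝ} (hκ : κ ≤ 1) (θ : ℝ) : LB κ θ ≤ minMax κ θ := by
  obtain ⟨x, hx⟩ := (isGreatest_LB κ θ).1
  obtain ⟨p, hp, h⟩ := (isLeast_minMax hκ θ).1
  rw [← hx, ← h]
  exact ((isLeast_innerMin hκ θ x).2 ⟨p, hp, rfl⟩).trans
    (div_le_div_of_nonneg_right (F_le_M θ p x) (denom_pos hp).le)

theorem LB'_le_minMax' {κ : ℝ} (hκ : κ ≤ 1) (θ : ℝ) : LB' κ θ ≤ minMax' κ θ := by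
  obtain ⟨x, hx⟩ := (isGreatest_LB' κ θ).1
  obtain ⟨r, hr, h⟩ := (isLeast_minMax' hκ θ).1
  rw [← hx, ← h]
  exact ((isLeast_innerMin' hκ θ x).2 ⟨r, hr, rfl⟩).trans (F_le_M θ _ x)

end Objective

/-! ### Cubic graphs and the matching of uncut edges -/

section Cubic

variable {V : Type*} {G : SimpleGraph V} {b : V → Fin 2}

/-- The neighbors of `u` are the three distinct vertices `x`, `y`, `z`. -/
structure HasNeighbors (G : SimpleGraph V) (u x y z : V) : Prop where
  ne₁₂ : x ≠ y
  ne₁₃ : x ≠ z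
  ne₂₃ : y ≠ z
  adj_iff : ∀ w, G.Adj u w ↔ w = x ∨ w = y ∨ w = z

namespace HasNeighbors

variable {u x y z : V}

theorem adj₁ (h : HasNeighbors G u x y z) : G.Adj u x := (h.adj_iff x).2 (Or.inl rfl)

theorem adj₂ (h : HasNeighbors G u x y z) : G.Adj u y := (h.adj_iff y).2 (Or.inr (Or.inl rfl))

theorem adj₃ (h : HasNeighbors G u x y z) : G.Adj u z := (h.adj_iff z).2 (Or.inr (Or.inr rfl))

theorem swap₁₂ (h : HasNeighbors G u x y z) : HasNeighbors G u y x z :=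
  ⟨h.ne₁₂.symm, h.ne₂₃, h.ne₁₃, fun w => (h.adj_iff w).trans (by tauto)⟩

theorem swap₂₃ (h : HasNeighbors G u x y z) : HasNeighbors G u x z y :=
  ⟨h.ne₁₃, h.ne₁₂, h.ne₂₃.symm, fun w => (h.adj_iff w).trans (by tauto)⟩

end HasNeighbors

/-- Every vertex has exactly three neighbors. -/
def IsCubic (G : SimpleGraph V) : Prop := ∀ u, ∃ x y z, HasNeighbors G u x y z

theorem IsCubic.of_isRegularOfDegree {_ : G.LocallyFinite} (h : G.IsRegularOfDegree 3) :
    IsCubic G := by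
  classical
  intro u
  obtain ⟨x, y, z, hxy, hxz, hyz, hs⟩ := Finset.card_eq_three.1 (h u)
  refine ⟨x, y, z, hxy, hxz, hyz, fun w => ?_⟩
  rw [← G.mem_neighborFinset, hs]
  simp

theorem IsCubic.exists_hasNeighbors₁ (hG : IsCubic G) {u x : V} (hx : G.Adj u x) :
    ∃ y z, HasNeighbors G u x y z := by
  obtain ⟨p, q, r, h⟩ := hG u
  rcases (h.adj_iff x).1 hx with rfl | rfl | rfl
  · exact ⟨q, r, h⟩
  · exact ⟨p, r, h.swap₁₂⟩
  · exact ⟨p, q, h.swap₂₃.swap₁₂⟩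

theorem IsCubic.exists_hasNeighbors₂ (hG : IsCubic G) {u x y : V} (hx : G.Adj u x)
    (hy : G.Adj u y) (hxy : x ≠ y) : ∃ z, HasNeighbors G u x y z := by
  obtain ⟨q, r, h⟩ := hG.exists_hasNeighbors₁ hx
  rcases (h.adj_iff y).1 hy with rfl | rfl | rfl
  · exact absurd rfl hxy
  · exact ⟨r, h⟩
  · exact ⟨q, h.swap₂₃⟩

theorem IsCubic.hasNeighbors (hG : IsCubic G) {u x y z : V} (hx : G.Adj u x)
    (hy : G.Adj u y) (hz : G.Adj u z) (hxy : x ≠ y) (hxz : x ≠ z) (hyz : y ≠ z) :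
    HasNeighbors G u x y z := by
  obtain ⟨w, h⟩ := hG.exists_hasNeighbors₂ hx hy hxy
  rcases (h.adj_iff z).1 hz with rfl | rfl | rfl
  · exact absurd rfl hxz
  · exact absurd rfl hyz
  · exact h

open Classical in
theorem HasNeighbors.sum_adj [Fintype V] {u x y z : V} (h : HasNeighbors G u x y z) {R : Type*}
    [AddCommMonoid R] (f : V → R) : (∑ w, if G.Adj u w then f w else 0) = f x + (f y + f z) := by
  have hs : (Finset.univ.filter fun w => G.Adj u w) = {x, y, z} := by
    ext w; simp [h.adj_iff]
  rw [← Finset.sum_filter, hs, Finset.sum_insert (by simp [h.ne₁₂, h.ne₁₃]),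
    Finset.sum_pair h.ne₂₃]

/-- No vertex is incident to two uncut edges. -/
def HasUncutMatching (G : SimpleGraph V) (b : V → Fin 2) : Prop :=
  ∀ ⦃u x y : V⦄, G.Adj u x → G.Adj u y → b u = b x → b u = b y → x = y

/-- If two of the three edges at `u` were uncut, flipping `u` would cut both and lose at most the
third, a net gain of at least one. -/
theorem hasUncutMatching_of_isBLSOptimal [Fintype V] [DecidableEq V] (hG : IsCubic G)
    (hb : IsBLSOptimal 1 G b) : HasUncutMatching G b := by
  classical
  intro u x y hx hy hbx hby
  by_contra hxy
  obtain ⟨z, h⟩ := hG.exists_hasNeighbors₂ hx hy hxy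
  set b' := Function.update b u (b u + 1) with hb'
  have hle : cut G b' ≤ cut G b := by
    refine hb b' ?_
    rw [hammingDist, ← Finset.card_singleton u]
    refine Finset.card_le_card fun w hw => ?_
    by_contra hwu
    simp only [Finset.mem_singleton] at hwu
    simp [hb', hwu] at hw
  have hsum : (cut G b' : ℤ) - cut G b =
      ∑ e ∈ edges G with u ∈ e, ((if IsCut b' e then 1 else 0) - if IsCut b e then 1 else 0) := by
    rw [cut_eq_sum, cut_eq_sum, ← Finset.sum_sub_distrib, Finset.sum_filter]
    refine Finset.sum_congr rfl fun e _ => ?_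
    induction e using Sym2.ind with
    | _ p q =>
      split_ifs <;> simp_all [isCut_mk, Sym2.mem_iff, Function.update_apply, eq_comm]
  rw [sum_edges_mem, h.sum_adj fun w => ((if IsCut b' s(u, w) then 1 else 0) -
    if IsCut b s(u, w) then 1 else 0 : ℤ)] at hsum
  have hflip : ∀ a : Fin 2, a + 1 ≠ a := by decide
  have e1 : b' u = b u + 1 := by simp [hb']
  have e2 : ∀ w, G.Adj u w → b' w = b w := fun w hw => by simp [hb', hw.ne.symm]
  simp only [isCut_mk, e1, e2 x hx, e2 y hy, e2 z h.adj₃, ← hbx, ← hby] at hsum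
  simp only [ne_eq, hflip, not_false_eq_true, if_true, not_true_eq_false, if_false] at hsum
  split_ifs at hsum <;> omega

theorem three_mul_card [Fintype V] (hG : IsCubic G) :
    3 * Fintype.card V = 2 * (edges G).card := by
  classical
  have h : edges G = G.edgeFinset := by ext e; simp [mem_edges]
  rw [h, ← G.sum_degrees_eq_twice_card_edges, Finset.sum_congr rfl (g := fun _ => 3)]
  · simp [mul_comm]
  · intro u _
    obtain ⟨x, y, z, h⟩ := hG u
    rw [← G.card_neighborFinset_eq_degree]
    exact Finset.card_eq_three.2 ⟨x, y, z, h.ne₁₂, h.ne₁₃, h.ne₂₃, by ext w; simp [h.adj_iff]⟩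

open Classical in
/-- The uncut edges with both endpoints of the given color. -/
def monochromatic [Fintype V] (G : SimpleGraph V) (b : V → Fin 2) (a : Fin 2) :
    Finset (Sym2 V) := {e ∈ edges G | ∀ v ∈ e, b v = a}

open Classical in
-- The edge itself counts, together with two further edges at each endpoint.
theorem card_edges_meeting [Fintype V] (hG : IsCubic G) {e : Sym2 V} (he : e ∈ edges G) :
    {e' ∈ edges G | ∃ v ∈ e, v ∈ e'}.card = 5 := by
  induction e using Sym2.ind with
  | _ u v =>
    have huv : G.Adj u v := by simpa [mem_edges] using he
    have hmem : ∀ e' : Sym2 V, (∃ w ∈ s(u, v), w ∈ e') ↔ (u ∈ e' ∨ v ∈ e') := by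
      intro e'; simp [Sym2.mem_iff]
    have hside : ∀ {u v : V}, G.Adj u v →
        (∑ w ∈ (Finset.univ.erase u).erase v, if G.Adj u w then 1 else 0) = 2 := by
      intro u v huv
      obtain ⟨x, y, h⟩ := hG.exists_hasNeighbors₁ huv
      rw [Finset.sum_boole, Nat.cast_id, Finset.card_eq_two]
      refine ⟨x, y, h.ne₂₃, ?_⟩
      ext w
      have hu : ∀ w, G.Adj u w → w ≠ u := fun w hw => hw.ne.symm
      have := hu x h.adj₂
      have := hu y h.adj₃
      have := h.ne₁₂
      have := h.ne₁₃
      simp only [Finset.mem_filter, Finset.mem_erase, Finset.mem_univ, h.adj_iff,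
        Finset.mem_insert, Finset.mem_singleton]
      grind
    rw [Finset.card_filter, sum_edges_of_adj G huv]
    · simp only [hmem]
      simp only [Sym2.mem_iff, true_or, or_true, if_true, Finset.sum_add_distrib]
      rw [hside huv, Finset.erase_right_comm, hside huv.symm]
      rfl
    · intro e' hu hv
      simp [hu, hv]

/-- The five-edge sets around distinct uncut edges of the same color are disjoint. This is the
source of `r₁, r₆ ≤ 1/5`. -/
theorem five_mul_card_monochromatic_le [Fintype V] (hG : IsCubic G) (hb : HasUncutMatching G b)
    (a : Fin 2) : 5 * (monochromatic G b a).card ≤ (edges G).card := by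
  classical
  have hmono : ∀ {u v : V}, s(u, v) ∈ monochromatic G b a ↔ G.Adj u v ∧ b u = a ∧ b v = a := by
    simp [monochromatic, mem_edges]
  have key : ∀ {u x y : V}, s(u, x) ∈ monochromatic G b a → s(u, y) ∈ monochromatic G b a →
      x = y := by
    intro u x y hx hy
    rw [hmono] at hx hy
    exact hb hx.1 hy.1 (hx.2.1.trans hx.2.2.symm) (hy.2.1.trans hy.2.2.symm)
  have hdisj : (monochromatic G b a : Set (Sym2 V)).PairwiseDisjoint
      fun e => {e' ∈ edges G | ∃ v ∈ e, v ∈ e'} := by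
    intro e₁ h₁ e₂ h₂ hne
    rw [Function.onFun, Finset.disjoint_left]
    intro e' h h'
    obtain ⟨he', v₁, ⟨w₁, rfl⟩, hv₁⟩ := Finset.mem_filter.1 h
    obtain ⟨-, v₂, ⟨w₂, rfl⟩, hv₂⟩ := Finset.mem_filter.1 h'
    rw [Finset.mem_coe] at h₁ h₂
    -- Either `e₁` and `e₂` share an endpoint, where the matching property makes them equal, or `e'`
    -- joins them. In the second case `e'` has both ends of color `a`, so it is uncut and coincides
    -- with each of them.
    by_cases hv : v₁ = v₂
    · subst hv
      exact hne (by rw [key h₁ h₂])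
    · have he : e' = s(v₁, v₂) := (Sym2.mem_and_mem_iff hv).1 ⟨hv₁, hv₂⟩
      subst he
      have h3 : s(v₁, v₂) ∈ monochromatic G b a :=
        hmono.2 ⟨by simpa [mem_edges] using he', (hmono.1 h₁).2.1, (hmono.1 h₂).2.1⟩
      have h4 := key h₁ h3
      have h5 := key h₂ (by rwa [Sym2.eq_swap])
      subst h4 h5
      exact hne Sym2.eq_swap
  calc 5 * (monochromatic G b a).card
      = ∑ e ∈ monochromatic G b a, {e' ∈ edges G | ∃ v ∈ e, v ∈ e'}.card := by
        have h5 : ∀ e ∈ monochromatic G b a, {e' ∈ edges G | ∃ v ∈ e, v ∈ e'}.card = 5 :=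
          fun e he => card_edges_meeting hG (Finset.mem_filter.1 he).1
        rw [Finset.sum_congr rfl h5]
        simp [mul_comm]
    _ = ((monochromatic G b a).biUnion fun e => {e' ∈ edges G | ∃ v ∈ e, v ∈ e'}).card :=
        (Finset.card_biUnion hdisj).symm
    _ ≤ (edges G).card :=
        Finset.card_le_card (Finset.biUnion_subset.2 fun e _ => Finset.filter_subset _ _)

end Cubic

/-! ### Diamonds and isolated triangles partition the edges in triangles -/

section Blocks

variable {V : Type*} {G : SimpleGraph V}

/-- Two triangles `abc` and `abd` sharing the edge `ab`. -/
structure IsDiamond (G : SimpleGraph V) (a b c d : V) : Prop where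
  ab : G.Adj a b
  ac : G.Adj a c
  ad : G.Adj a d
  bc : G.Adj b c
  bd : G.Adj b d
  cd : c ≠ d
  not_cd : ¬ G.Adj c d

/-- A triangle `abc` that shares no edge with another triangle. -/
structure IsIsolatedTriangle (G : SimpleGraph V) (a b c : V) : Prop where
  ab : G.Adj a b
  ac : G.Adj a c
  bc : G.Adj b c
  eq_c : ∀ w, G.Adj a w → G.Adj b w → w = c
  eq_b : ∀ w, G.Adj a w → G.Adj c w → w = b
  eq_a : ∀ w, G.Adj b w → G.Adj c w → w = a

open Classical in
/-- The vertex set of a diamond or of an isolated triangle. -/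
def IsBlock (G : SimpleGraph V) (B : Finset V) : Prop :=
  (∃ a b c d, IsDiamond G a b c d ∧ B = {a, b, c, d}) ∨
    ∃ a b c, IsIsolatedTriangle G a b c ∧ B = {a, b, c}

/-- Two triangles through a vertex of degree three share an edge there. An isolated triangle admits
no second one. In a diamond the vertices `a` and `b` have no outside neighbors, and `c` and `d`,
which are not adjacent, have one each, which closes no triangle. -/
theorem IsBlock.mem_of_triangle (hG : IsCubic G) {B : Finset V} (hB : IsBlock G B) {v w x : V}
    (hv : v ∈ B) (hvw : G.Adj v w) (hvx : G.Adj v x) (hwx : G.Adj w x) : w ∈ B := by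
  rcases hB with ⟨a, b, c, d, h, rfl⟩ | ⟨a, b, c, h, rfl⟩
  · have na := hG.hasNeighbors h.ab h.ac h.ad h.bc.ne h.bd.ne h.cd
    have nb := hG.hasNeighbors h.ab.symm h.bc h.bd h.ac.ne h.ad.ne h.cd
    obtain ⟨c', nc⟩ := hG.exists_hasNeighbors₂ h.ac.symm h.bc.symm h.ab.ne
    obtain ⟨d', nd⟩ := hG.exists_hasNeighbors₂ h.ad.symm h.bd.symm h.ab.ne
    have ia := na.adj_iff
    have ib := nb.adj_iff
    have ic := nc.adj_iff
    have id := nd.adj_iff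
    have hxw := hwx.symm
    have hne := hwx.ne
    simp only [Finset.mem_insert, Finset.mem_singleton] at hv ⊢
    rcases hv with rfl | rfl | rfl | rfl <;> grind
  · obtain ⟨a', na⟩ := hG.exists_hasNeighbors₂ h.ab h.ac h.bc.ne
    obtain ⟨b', nb⟩ := hG.exists_hasNeighbors₂ h.ab.symm h.bc h.ac.ne
    obtain ⟨c', nc⟩ := hG.exists_hasNeighbors₂ h.ac.symm h.bc.symm h.ab.ne
    have ia := na.adj_iff
    have ib := nb.adj_iff
    have ic := nc.adj_iff
    have ec := h.eq_c
    have eb := h.eq_b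
    have ea := h.eq_a
    have hxw := hwx.symm
    have hne := hwx.ne
    simp only [Finset.mem_insert, Finset.mem_singleton] at hv ⊢
    rcases hv with rfl | rfl | rfl <;> grind

/-- Triangles inside `B` lead from any of its vertices to `a`, and from `a` to all others; each such
step stays in `C`. -/
theorem IsBlock.subset_of_mem (hG : IsCubic G) {B C : Finset V} (hB : IsBlock G B)
    (hC : IsBlock G C) {v : V} (hv : v ∈ B) (hv' : v ∈ C) : B ⊆ C := by
  have key : ∀ {v w x : V}, v ∈ C → G.Adj v w → G.Adj v x → G.Adj w x → w ∈ C :=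
    fun h h₁ h₂ h₃ => hC.mem_of_triangle hG h h₁ h₂ h₃
  rcases hB with ⟨a, b, c, d, h, rfl⟩ | ⟨a, b, c, h, rfl⟩
  · have ha : a ∈ C := by
      simp only [Finset.mem_insert, Finset.mem_singleton] at hv
      rcases hv with rfl | rfl | rfl | rfl
      · exact hv'
      · exact key hv' h.ab.symm h.bc h.ac
      · exact key hv' h.ac.symm h.bc.symm h.ab
      · exact key hv' h.ad.symm h.bd.symm h.ab
    intro w hw
    simp only [Finset.mem_insert, Finset.mem_singleton] at hw
    rcases hw with rfl | rfl | rfl | rfl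
    · exact ha
    · exact key ha h.ab h.ac h.bc
    · exact key ha h.ac h.ab h.bc.symm
    · exact key ha h.ad h.ab h.bd.symm
  · have ha : a ∈ C := by
      simp only [Finset.mem_insert, Finset.mem_singleton] at hv
      rcases hv with rfl | rfl | rfl
      · exact hv'
      · exact key hv' h.ab.symm h.bc h.ac
      · exact key hv' h.ac.symm h.bc.symm h.ab
    intro w hw
    simp only [Finset.mem_insert, Finset.mem_singleton] at hw
    rcases hw with rfl | rfl | rfl
    · exact ha
    · exact key ha h.ab h.ac h.bc
    · exact key ha h.ac h.ab h.bc.symm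

theorem IsBlock.eq_of_mem (hG : IsCubic G) {B C : Finset V} (hB : IsBlock G B)
    (hC : IsBlock G C) {v : V} (hv : v ∈ B) (hv' : v ∈ C) : B = C :=
  (hB.subset_of_mem hG hC hv hv').antisymm (hC.subset_of_mem hG hB hv' hv)

theorem CliqueFree.not_isK4 (hG : G.CliqueFree 4) {a b c d : V} (ab : G.Adj a b) (ac : G.Adj a c)
    (ad : G.Adj a d) (bc : G.Adj b c) (bd : G.Adj b d) : ¬ G.Adj c d := by
  classical
  intro cd
  exact hG _ ((SimpleGraph.is3Clique_triple_iff.2 ⟨bc, bd, cd⟩).insert (a := a) (by simp [ab, ac, ad]))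

/-- If a second triangle contains an edge of this one, the two form a diamond since `K₄` is
excluded; otherwise the triangle is isolated. -/
theorem exists_isBlock_of_triangle (hG : G.CliqueFree 4) {a b c : V} (ab : G.Adj a b)
    (ac : G.Adj a c) (bc : G.Adj b c) : ∃ B, IsBlock G B ∧ a ∈ B ∧ b ∈ B := by
  classical
  by_cases hc : ∃ w, G.Adj a w ∧ G.Adj b w ∧ w ≠ c
  · obtain ⟨w, aw, bw, hw⟩ := hc
    exact ⟨{a, b, c, w}, Or.inl ⟨a, b, c, w, ⟨ab, ac, aw, bc, bw, hw.symm,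
      CliqueFree.not_isK4 hG ab ac aw bc bw⟩, rfl⟩, by simp, by simp⟩
  by_cases hb : ∃ w, G.Adj a w ∧ G.Adj c w ∧ w ≠ b
  · obtain ⟨w, aw, cw, hw⟩ := hb
    exact ⟨{a, c, b, w}, Or.inl ⟨a, c, b, w, ⟨ac, ab, aw, bc.symm, cw, hw.symm,
      CliqueFree.not_isK4 hG ac ab aw bc.symm cw⟩, rfl⟩, by simp, by simp⟩
  by_cases ha : ∃ w, G.Adj b w ∧ G.Adj c w ∧ w ≠ a
  · obtain ⟨w, bw, cw, hw⟩ := ha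
    exact ⟨{b, c, a, w}, Or.inl ⟨b, c, a, w, ⟨bc, ab.symm, bw, ac.symm, cw, hw.symm,
      CliqueFree.not_isK4 hG bc ab.symm bw ac.symm cw⟩, rfl⟩, by simp, by simp⟩
  push Not at ha hb hc
  exact ⟨{a, b, c}, Or.inr ⟨a, b, c, ⟨ab, ac, bc, hc, hb, ha⟩, rfl⟩, by simp, by simp⟩

variable [Fintype V]

open Classical in
/-- The edges with both endpoints in `B`. -/
def edgesIn (G : SimpleGraph V) (B : Finset V) : Finset (Sym2 V) :=
  {e ∈ edges G | ∀ v ∈ e, v ∈ B}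

open Classical in
/-- The vertex sets of diamonds and isolated triangles. -/
def blocks (G : SimpleGraph V) : Finset (Finset V) := {B | IsBlock G B}

open Classical in
/-- The edges that lie in no triangle. -/
def triangleFreeEdges (G : SimpleGraph V) : Finset (Sym2 V) :=
  {e ∈ edges G | ¬ ∃ x, ∀ v ∈ e, G.Adj v x}

theorem mem_blocks {B : Finset V} : B ∈ blocks G ↔ IsBlock G B := by simp [blocks]

theorem mem_edgesIn {B : Finset V} {u v : V} :
    s(u, v) ∈ edgesIn G B ↔ G.Adj u v ∧ u ∈ B ∧ v ∈ B := by
  simp [edgesIn, mem_edges]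

theorem mem_triangleFreeEdges {u v : V} :
    s(u, v) ∈ triangleFreeEdges G ↔ G.Adj u v ∧ ∀ x, G.Adj u x → ¬ G.Adj v x := by
  simp [triangleFreeEdges, mem_edges]

theorem IsBlock.exists_triangle {B : Finset V} (hB : IsBlock G B) {u v : V}
    (he : s(u, v) ∈ edgesIn G B) : ∃ x, G.Adj u x ∧ G.Adj v x := by
  obtain ⟨huv, hu, hv⟩ := mem_edgesIn.1 he
  rcases hB with ⟨a, b, c, d, h, rfl⟩ | ⟨a, b, c, h, rfl⟩
  · obtain ⟨h1, h2, h3, h4, h5, -, h6⟩ := h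
    have := huv.ne
    simp only [Finset.mem_insert, Finset.mem_singleton] at hu hv
    rcases hu with rfl | rfl | rfl | rfl <;> rcases hv with rfl | rfl | rfl | rfl <;>
      first
      | exact absurd rfl this
      | exact absurd huv h6
      | exact absurd huv.symm h6
      | exact ⟨_, h2, h4⟩
      | exact ⟨_, h4, h2⟩
      | exact ⟨_, h1, h4.symm⟩
      | exact ⟨_, h1, h5.symm⟩
      | exact ⟨_, h4.symm, h1⟩
      | exact ⟨_, h5.symm, h1⟩
      | exact ⟨_, h1.symm, h2.symm⟩
      | exact ⟨_, h1.symm, h3.symm⟩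
      | exact ⟨_, h2.symm, h1.symm⟩
      | exact ⟨_, h3.symm, h1.symm⟩
  · obtain ⟨h1, h2, h3, -⟩ := h
    have := huv.ne
    simp only [Finset.mem_insert, Finset.mem_singleton] at hu hv
    rcases hu with rfl | rfl | rfl <;> rcases hv with rfl | rfl | rfl <;>
      first
      | exact absurd rfl this
      | exact ⟨_, h2, h3⟩
      | exact ⟨_, h3, h2⟩
      | exact ⟨_, h1, h3.symm⟩
      | exact ⟨_, h3.symm, h1⟩
      | exact ⟨_, h1.symm, h2.symm⟩
      | exact ⟨_, h2.symm, h1.symm⟩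

theorem blocks_pairwiseDisjoint (hG : IsCubic G) :
    (blocks G : Set (Finset V)).PairwiseDisjoint id := by
  intro B hB C hC hne
  refine Finset.disjoint_left.2 fun v hv hv' => hne ?_
  exact (mem_blocks.1 hB).eq_of_mem hG (mem_blocks.1 hC) hv hv'

/-- An edge lies in a triangle exactly when it lies inside a block, and the block is unique because
blocks are disjoint. -/
theorem sum_edges_eq_sum_blocks (hG : IsCubic G) (hK : G.CliqueFree 4) {R : Type*}
    [AddCommMonoid R] (f : Sym2 V → R) :
    ∑ e ∈ edges G, f e =
      ∑ B ∈ blocks G, ∑ e ∈ edgesIn G B, f e + ∑ e ∈ triangleFreeEdges G, f e := by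
  classical
  rw [← Finset.sum_biUnion]
  · rw [triangleFreeEdges,
      ← Finset.sum_filter_add_sum_filter_not (edges G) (fun e => ∃ x, ∀ v ∈ e, G.Adj v x)]
    congr 1
    refine Finset.sum_congr ?_ fun _ _ => rfl
    ext e
    induction e using Sym2.ind with
    | _ u v =>
      simp only [Finset.mem_filter, mem_edges, SimpleGraph.mem_edgeSet, Sym2.mem_iff,
        forall_eq_or_imp, forall_eq, Finset.mem_biUnion, mem_blocks, mem_edgesIn]
      constructor
      · rintro ⟨huv, x, hu, hv⟩
        obtain ⟨B, hB, hu, hv⟩ := exists_isBlock_of_triangle hK huv hu hv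
        exact ⟨B, hB, huv, hu, hv⟩
      · rintro ⟨B, hB, h⟩
        exact ⟨h.1, hB.exists_triangle (mem_edgesIn.2 h)⟩
  · intro B hB C hC hne
    refine Finset.disjoint_left.2 fun e he he' => ?_
    induction e using Sym2.ind with
    | _ u v =>
      exact hne ((mem_blocks.1 hB).eq_of_mem hG (mem_blocks.1 hC) (mem_edgesIn.1 he).2.1
        (mem_edgesIn.1 he').2.1)

theorem IsDiamond.sum_edgesIn [DecidableEq V] {a b c d : V} (h : IsDiamond G a b c d) {R : Type*}
    [AddCommMonoid R] (f : Sym2 V → R) :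
    ∑ e ∈ edgesIn G {a, b, c, d}, f e =
      f s(a, b) + (f s(a, c) + (f s(a, d) + (f s(b, c) + f s(b, d)))) := by
  obtain ⟨h1, h2, h3, h4, h5, h6, h7⟩ := h
  have hs : edgesIn G {a, b, c, d} = {s(a, b), s(a, c), s(a, d), s(b, c), s(b, d)} := by
    ext e
    induction e using Sym2.ind with
    | _ u v =>
      have e1 := h1.symm
      have e2 := h2.symm
      have e3 := h3.symm
      have e4 := h4.symm
      have e5 := h5.symm
      have e7 : ¬ G.Adj d c := fun h => h7 h.symm
      simp only [mem_edgesIn, Finset.mem_insert, Finset.mem_singleton, Sym2.eq_iff]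
      constructor
      · rintro ⟨huv, rfl | rfl | rfl | rfl, rfl | rfl | rfl | rfl⟩ <;> simp_all
      · rintro ((⟨rfl, rfl⟩ | ⟨rfl, rfl⟩) | (⟨rfl, rfl⟩ | ⟨rfl, rfl⟩) | (⟨rfl, rfl⟩ | ⟨rfl, rfl⟩) |
          (⟨rfl, rfl⟩ | ⟨rfl, rfl⟩) | (⟨rfl, rfl⟩ | ⟨rfl, rfl⟩)) <;> simp [*]
  have := h1.ne
  have := h2.ne
  have := h3.ne
  have := h4.ne
  have := h5.ne
  rw [hs, Finset.sum_insert, Finset.sum_insert, Finset.sum_insert, Finset.sum_insert,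
    Finset.sum_singleton] <;>
  · simp only [Finset.mem_insert, Finset.mem_singleton, Sym2.eq_iff]
    grind

theorem IsIsolatedTriangle.sum_edgesIn [DecidableEq V] {a b c : V}
    (h : IsIsolatedTriangle G a b c) {R : Type*} [AddCommMonoid R] (f : Sym2 V → R) :
    ∑ e ∈ edgesIn G {a, b, c}, f e = f s(a, b) + (f s(a, c) + f s(b, c)) := by
  obtain ⟨h1, h2, h3, -⟩ := h
  have hs : edgesIn G {a, b, c} = {s(a, b), s(a, c), s(b, c)} := by
    ext e
    induction e using Sym2.ind with
    | _ u v =>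
      have e1 := h1.symm
      have e2 := h2.symm
      have e3 := h3.symm
      simp only [mem_edgesIn, Finset.mem_insert, Finset.mem_singleton, Sym2.eq_iff]
      constructor
      · rintro ⟨huv, rfl | rfl | rfl, rfl | rfl | rfl⟩ <;> simp_all
      · rintro ((⟨rfl, rfl⟩ | ⟨rfl, rfl⟩) | (⟨rfl, rfl⟩ | ⟨rfl, rfl⟩) |
          (⟨rfl, rfl⟩ | ⟨rfl, rfl⟩)) <;> simp [*]
  have := h1.ne
  have := h2.ne
  have := h3.ne
  rw [hs, Finset.sum_insert, Finset.sum_insert, Finset.sum_singleton] <;>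
  · simp only [Finset.mem_insert, Finset.mem_singleton, Sym2.eq_iff]
    grind

end Blocks

/-! ### Classification of colored edge neighborhoods -/

section Types

/-- The index of the colored neighborhood of an edge with two common neighbors. -/
def type4 (u v : Fin 2) : Fin 3 := if u = v then (if u = 1 then 0 else 2) else 1

/-- The index of the colored neighborhood of an edge `uv` with one common neighbor `x`, the third
neighbors of `u` and `v` being `y` and `z`. -/
def type5 (u v x y z : Fin 2) : Fin 6 :=
  if u = v then (if u = 1 then 0 else 5)
  else if u = 0 then
    (if x = 0 then (if z = 0 then 1 else 3) else (if y = 0 then 2 else 4))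
  else
    (if x = 0 then (if y = 0 then 1 else 3) else (if z = 0 then 2 else 4))

/-- The index of the colored neighborhood of an edge `uv` without common neighbors, the other
neighbors of `u` and `v` being `x, y` and `z, w`. -/
def type6 (u v x y z w : Fin 2) : Fin 6 :=
  if u = v then (if u = 1 then 0 else 5)
  else if u = 0 then
    (if x = 1 ∧ y = 1 then (if z = 0 ∧ w = 0 then 2 else 4)
      else (if z = 0 ∧ w = 0 then 1 else 3))
  else
    (if z = 1 ∧ w = 1 then (if x = 0 ∧ y = 0 then 2 else 4)
      else (if x = 0 ∧ y = 0 then 1 else 3))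

variable {V : Type*} {G : SimpleGraph V} {b : V → Fin 2}

/-- The value of `h` at an edge is determined by the colored neighborhood of the edge: it is given
by `α`, `β`, `γ` for edges with two, one and no common neighbors. -/
structure IsNeighborhoodFunction (G : SimpleGraph V) (b : V → Fin 2) (h : Sym2 V → ℝ)
    (α : Fin 3 → ℝ) (β γ : Fin 6 → ℝ) : Prop where
  eq₄ : ∀ {u v x y : V}, HasNeighbors G u v x y → HasNeighbors G v u x y →
    h s(u, v) = α (type4 (b u) (b v))
  eq₅ : ∀ {u v x y z : V}, HasNeighbors G u v x y → HasNeighbors G v u x z → y ≠ z →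
    h s(u, v) = β (type5 (b u) (b v) (b x) (b y) (b z))
  eq₆ : ∀ {u v x y z w : V}, HasNeighbors G u v x y → HasNeighbors G v u z w → x ≠ z → x ≠ w →
    y ≠ z → y ≠ w → h s(u, v) = γ (type6 (b u) (b v) (b x) (b y) (b z) (b w))

/-- At most one of the bits `x`, `y`, `z` agrees with `u`. -/
def AtMostOneEq (u x y z : Fin 2) : Prop :=
  ¬ (u = x ∧ u = y) ∧ ¬ (u = x ∧ u = z) ∧ ¬ (u = y ∧ u = z)

instance (u x y z : Fin 2) : Decidable (AtMostOneEq u x y z) := by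
  unfold AtMostOneEq; infer_instance

theorem HasUncutMatching.atMostOneEq (hb : HasUncutMatching G b) {u x y z : V}
    (h : HasNeighbors G u x y z) : AtMostOneEq (b u) (b x) (b y) (b z) :=
  ⟨fun h' => h.ne₁₂ (hb h.adj₁ h.adj₂ h'.1 h'.2), fun h' => h.ne₁₃ (hb h.adj₁ h.adj₃ h'.1 h'.2),
    fun h' => h.ne₂₃ (hb h.adj₂ h.adj₃ h'.1 h'.2)⟩

variable [Fintype V] [DecidableEq V] {u v x y z w : V}

theorem edgeCutProb_eq_f4 (hu : HasNeighbors G u v x y) (hv : HasNeighbors G v u x y) (i : Fin 3)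
    (hb : ![b u, b v, b x, b y] = color4 i) (θ γ β : ℝ) :
    edgeCutProb G b s(u, v) θ γ β = f4 i θ γ β := by
  have h1 := hu.adj₁.ne
  have h2 := hu.adj₂.ne
  have h3 := hu.adj₃.ne
  have h4 := hv.adj₂.ne
  have h5 := hv.adj₃.ne
  have h6 := hu.ne₂₃
  refine edgeCutProb_eq_of_embedding G g4 b (color4 i) ![u, v, x, y] ?_ (u := 0) (v := 1)
    (by simp [g4]) ?_ ?_ ?_ ?_ ?_ θ γ β
  · intro p q
    fin_cases p <;> fin_cases q <;> simp [*, Ne.symm, eq_comm]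
  · intro p
    fin_cases p <;> simp [g4, hu.adj_iff, *]
  · intro p
    fin_cases p <;> simp [g4, hv.adj_iff, *]
  · intro p hp
    rcases (hu.adj_iff p).1 hp with rfl | rfl | rfl <;> simp
  · intro p hp
    rcases (hv.adj_iff p).1 hp with rfl | rfl | rfl <;> simp
  · intro p
    rw [← hb]
    fin_cases p <;> rfl

theorem edgeCutProb_eq_f5 (hu : HasNeighbors G u v x y) (hv : HasNeighbors G v u x z) (hyz : y ≠ z)
    (i : Fin 6) (hb : ![b u, b v, b x, b y, b z] = color5 i) (θ γ β : ℝ) :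
    edgeCutProb G b s(u, v) θ γ β = f5 i θ γ β := by
  have h1 := hu.adj₁.ne
  have h2 := hu.adj₂.ne
  have h3 := hu.adj₃.ne
  have h4 := hv.adj₂.ne
  have h5 := hv.adj₃.ne
  have h6 := hu.ne₂₃
  have h7 := hu.ne₁₃
  have h8 := hv.ne₁₃
  have h9 := hv.ne₂₃
  refine edgeCutProb_eq_of_embedding G g5 b (color5 i) ![u, v, x, y, z] ?_ (u := 0) (v := 1)
    (by simp [g5]) ?_ ?_ ?_ ?_ ?_ θ γ β
  · intro p q
    fin_cases p <;> fin_cases q <;> simp [*, Ne.symm, eq_comm]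
  · intro p
    fin_cases p <;> simp [g5, hu.adj_iff, h5.symm, h9.symm, hyz.symm, *]
  · intro p
    fin_cases p <;> simp [g5, hv.adj_iff, h3.symm, h6.symm, *]
  · intro p hp
    rcases (hu.adj_iff p).1 hp with rfl | rfl | rfl <;> simp
  · intro p hp
    rcases (hv.adj_iff p).1 hp with rfl | rfl | rfl <;> simp
  · intro p
    rw [← hb]
    fin_cases p <;> rfl

theorem edgeCutProb_eq_f6 (hu : HasNeighbors G u v x y) (hv : HasNeighbors G v u z w)
    (hxz : x ≠ z) (hxw : x ≠ w) (hyz : y ≠ z) (hyw : y ≠ w) (i : Fin 6)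
    (hb : ![b u, b v, b x, b y, b z, b w] = color6 i) (θ γ β : ℝ) :
    edgeCutProb G b s(u, v) θ γ β = f6 i θ γ β := by
  have h1 := hu.adj₁.ne
  have h2 := hu.adj₂.ne
  have h3 := hu.adj₃.ne
  have h4 := hv.adj₂.ne
  have h5 := hv.adj₃.ne
  have h6 := hu.ne₂₃
  have h7 := hu.ne₁₃
  have h8 := hv.ne₁₃
  have h9 := hv.ne₂₃
  have h10 := hu.ne₁₂
  have h11 := hv.ne₁₂
  refine edgeCutProb_eq_of_embedding G g6 b (color6 i) ![u, v, x, y, z, w] ?_ (u := 0) (v := 1)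
    (by simp [g6]) ?_ ?_ ?_ ?_ ?_ θ γ β
  · intro p q
    fin_cases p <;> fin_cases q <;> simp [*, Ne.symm, eq_comm]
  · intro p
    fin_cases p <;> simp [g6, hu.adj_iff, h4.symm, h5.symm, hxz.symm, hxw.symm, hyz.symm, hyw.symm, *]
  · intro p
    fin_cases p <;> simp [g6, hv.adj_iff, h2.symm, h3.symm, *]
  · intro p hp
    rcases (hu.adj_iff p).1 hp with rfl | rfl | rfl <;> simp
  · intro p hp
    rcases (hv.adj_iff p).1 hp with rfl | rfl | rfl <;> simp
  · intro p
    rw [← hb]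
    fin_cases p <;> rfl

end Types

/-! ### Cut probabilities as functions of the colored neighborhood -/

section NeighborhoodFunctions

variable {V : Type*} {G : SimpleGraph V} {b : V → Fin 2}

theorem one_isNeighborhoodFunction :
    IsNeighborhoodFunction G b (fun _ => 1) (fun _ => 1) (fun _ => 1) (fun _ => 1) :=
  ⟨fun _ _ => rfl, fun _ _ _ => rfl, fun _ _ _ _ _ _ => rfl⟩

variable [Fintype V]

theorem color4_type4 : ∀ u v x y : Fin 2, AtMostOneEq u v x y → AtMostOneEq v u x y →
    ![u, v, x, y] = color4 (type4 u v) ∨ ![u, v, y, x] = color4 (type4 u v) ∨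
    ![v, u, x, y] = color4 (type4 u v) ∨ ![v, u, y, x] = color4 (type4 u v) := by
  decide

theorem color5_type5 : ∀ u v x y z : Fin 2, AtMostOneEq u v x y → AtMostOneEq v u x z →
    ![u, v, x, y, z] = color5 (type5 u v x y z) ∨
      ![v, u, x, z, y] = color5 (type5 u v x y z) := by
  decide

set_option maxRecDepth 4000 in
set_option synthInstance.maxSize 1000 in
set_option synthInstance.maxHeartbeats 200000 in
-- The alternatives are the eight symmetries of `g6` fixing the central edge: exchanging its
-- endpoints and swapping the leaves at either one.
theorem color6_type6 : ∀ u v x y z w : Fin 2, AtMostOneEq u v x y → AtMostOneEq v u z w →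
    ![u, v, x, y, z, w] = color6 (type6 u v x y z w) ∨
    ![u, v, y, x, z, w] = color6 (type6 u v x y z w) ∨
    ![u, v, x, y, w, z] = color6 (type6 u v x y z w) ∨
    ![u, v, y, x, w, z] = color6 (type6 u v x y z w) ∨
    ![v, u, z, w, x, y] = color6 (type6 u v x y z w) ∨
    ![v, u, w, z, x, y] = color6 (type6 u v x y z w) ∨
    ![v, u, z, w, y, x] = color6 (type6 u v x y z w) ∨
    ![v, u, w, z, y, x] = color6 (type6 u v x y z w) := by
  decide

theorem edgeCutProb_isNeighborhoodFunction [DecidableEq V] (hb : HasUncutMatching G b)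
    (θ γ β : ℝ) :
    IsNeighborhoodFunction G b (fun e => edgeCutProb G b e θ γ β) (f4 · θ γ β) (f5 · θ γ β)
      (f6 · θ γ β) where
  eq₄ {u v x y} hu hv := by
    rcases color4_type4 _ _ _ _ (hb.atMostOneEq hu) (hb.atMostOneEq hv) with
      h | h | h | h
    · exact edgeCutProb_eq_f4 hu hv _ h θ γ β
    · exact edgeCutProb_eq_f4 hu.swap₂₃ hv.swap₂₃ _ h θ γ β
    all_goals rw [Sym2.eq_swap]
    · exact edgeCutProb_eq_f4 hv hu _ h θ γ β
    · exact edgeCutProb_eq_f4 hv.swap₂₃ hu.swap₂₃ _ h θ γ β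
  eq₅ {u v x y z} hu hv hyz := by
    rcases color5_type5 _ _ _ _ _ (hb.atMostOneEq hu) (hb.atMostOneEq hv) with h | h
    · exact edgeCutProb_eq_f5 hu hv hyz _ h θ γ β
    · rw [Sym2.eq_swap]
      exact edgeCutProb_eq_f5 hv hu hyz.symm _ h θ γ β
  eq₆ {u v x y z w} hu hv hxz hxw hyz hyw := by
    rcases color6_type6 _ _ _ _ _ _ (hb.atMostOneEq hu) (hb.atMostOneEq hv) with
      h | h | h | h | h | h | h | h
    · exact edgeCutProb_eq_f6 hu hv hxz hxw hyz hyw _ h θ γ β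
    · exact edgeCutProb_eq_f6 hu.swap₂₃ hv hyz hyw hxz hxw _ h θ γ β
    · exact edgeCutProb_eq_f6 hu hv.swap₂₃ hxw hxz hyw hyz _ h θ γ β
    · exact edgeCutProb_eq_f6 hu.swap₂₃ hv.swap₂₃ hyw hyz hxw hxz _ h θ γ β
    all_goals rw [Sym2.eq_swap]
    · exact edgeCutProb_eq_f6 hv hu hxz.symm hyz.symm hxw.symm hyw.symm _ h θ γ β
    · exact edgeCutProb_eq_f6 hv.swap₂₃ hu hxw.symm hyw.symm hxz.symm hyz.symm _ h θ γ β
    · exact edgeCutProb_eq_f6 hv hu.swap₂₃ hyz.symm hxz.symm hyw.symm hxw.symm _ h θ γ β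
    · exact edgeCutProb_eq_f6 hv.swap₂₃ hu.swap₂₃ hyw.symm hxw.symm hyz.symm hxz.symm _ h θ γ β

end NeighborhoodFunctions

/-! ### The linear form and the contributions of single blocks -/

section Params

theorem linearForm_add (p q : Params) (a : Fin 3 → ℝ) (b c : Fin 6 → ℝ) :
    linearForm (p + q) a b c = linearForm p a b c + linearForm q a b c := by
  simp only [linearForm, Prod.fst_add, Prod.snd_add, Pi.add_apply, add_mul,
    Finset.sum_add_distrib]
  ring

theorem linearForm_smul (k : ℝ) (p : Params) (a : Fin 3 → ℝ) (b c : Fin 6 → ℝ) :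
    linearForm (k • p) a b c = k * linearForm p a b c := by
  simp only [linearForm, Prod.smul_fst, Prod.smul_snd, Pi.smul_apply, smul_eq_mul, mul_assoc,
    ← Finset.mul_sum]
  ring

theorem linearForm_sum {ι : Type*} (s : Finset ι) (p : ι → Params) (a : Fin 3 → ℝ)
    (b c : Fin 6 → ℝ) :
    linearForm (∑ i ∈ s, p i) a b c = ∑ i ∈ s, linearForm (p i) a b c := by
  classical
  induction s using Finset.induction_on with
  | empty => simp [linearForm]
  | insert i s hi ih => rw [Finset.sum_insert hi, Finset.sum_insert hi, linearForm_add, ih]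

/-- A weighted count of diamonds and isolated triangles. -/
def blockWeight (x y : ℝ) (p : Params) : ℝ := x * ∑ i, p.2.1 i + y * ∑ i, p.2.2 i

theorem blockWeight_add (x y : ℝ) (p q : Params) :
    blockWeight x y (p + q) = blockWeight x y p + blockWeight x y q := by
  simp only [blockWeight, Prod.snd_add, Prod.fst_add, Pi.add_apply, Finset.sum_add_distrib]
  ring

theorem blockWeight_sum {ι : Type*} (s : Finset ι) (x y : ℝ) (p : ι → Params) :
    blockWeight x y (∑ i ∈ s, p i) = ∑ i ∈ s, blockWeight x y (p i) := by
  classical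
  induction s using Finset.induction_on with
  | empty => simp [blockWeight]
  | insert i s hi ih => rw [Finset.sum_insert hi, Finset.sum_insert hi, blockWeight_add, ih]

/-- The index of a colored diamond `abcd` with central edge `ab`, the third neighbors of `c` and
`d` being `c'` and `d'`. -/
def diamondType (a b c' d' : Fin 2) : Fin 7 :=
  if a = b then
    if a = 1 then (if c' = d' then (if c' = 0 then 1 else 5) else 2)
    else (if c' = d' then (if c' = 0 then 0 else 6) else 4)
  else 3

/-- The index of a colored isolated triangle `abc`, the third neighbors being `a'`, `b'`, `c'`. -/
def triangleType (a b c a' b' c' : Fin 2) : Fin 4 :=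
  if a = b then triangleType' a c' else if a = c then triangleType' a b' else triangleType' b a'
where
  /-- The index, given the color of the uncut edge and of the opposite third neighbor. -/
  triangleType' (a w : Fin 2) : Fin 4 :=
    if a = 1 then (if w = 0 then 0 else 1) else (if w = 0 then 2 else 3)

/-- If `a = b`, then `c` and `d` have the opposite color and only `c'` and `d'` are free: three
kinds per color, up to exchange. If `a ≠ b`, then `c ≠ d` and the colors of `c'` and `d'` are
forced, which leaves the kind `s₁₂`. -/
theorem linearForm_diamondType (α : Fin 3 → ℝ) (β γ : Fin 6 → ℝ) : ∀ a b c d c' d' : Fin 2,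
    AtMostOneEq a b c d → AtMostOneEq b a c d → AtMostOneEq c a b c' → AtMostOneEq d a b d' →
    α (type4 a b) + (β (type5 a c b d c') + (β (type5 a d b c d') + (β (type5 b c a d c') +
      β (type5 b d a c d')))) =
      linearForm (0, Pi.single (diamondType a b c' d') 1, 0) α β γ := by
  intro a b c d c' d' h1 h2 h3 h4
  fin_cases a <;> fin_cases b <;> fin_cases c <;> fin_cases d <;>
    first
    | (exfalso; revert h1 h2; decide)
    | (fin_cases c' <;> fin_cases d' <;>
        first
        | (exfalso; revert h3 h4; decide)
        | (simp [type4, type5, diamondType, linearForm]; try ring))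

/-- Exactly one edge of the triangle is uncut, and the third neighbors of its ends have the opposite
color. Its color and the third neighbor of the opposite vertex are free, hence four kinds. -/
theorem linearForm_triangleType (α : Fin 3 → ℝ) (β γ : Fin 6 → ℝ) : ∀ a b c a' b' c' : Fin 2,
    AtMostOneEq a b c a' → AtMostOneEq b a c b' → AtMostOneEq c a b c' →
    β (type5 a b c a' b') + (β (type5 a c b a' c') + β (type5 b c a b' c')) =
      linearForm (0, 0, Pi.single (triangleType a b c a' b' c') 1) α β γ := by
  intro a b c a' b' c' h1 h2 h3
  fin_cases a <;> fin_cases b <;> fin_cases c <;>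
    first
    | (exfalso; revert h1; decide +revert)
    | (fin_cases a' <;> fin_cases b' <;> fin_cases c' <;>
        first
        | (exfalso; revert h1 h2 h3; decide)
        | (simp [type5, triangleType, triangleType.triangleType', linearForm]
           try ring))

theorem linearForm_single (i : Fin 6) (α : Fin 3 → ℝ) (β γ : Fin 6 → ℝ) :
    linearForm (Pi.single i 1, 0, 0) α β γ = γ i := by
  simp [linearForm, Pi.single_apply]

end Params

/-! ### Counting neighborhoods and comparing with the maximum cut -/

section Counting

variable {V : Type*} [Fintype V] {G : SimpleGraph V} {b : V → Fin 2}

/-- The contribution of a block to the parameters. -/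
theorem IsBlock.exists_params (hG : IsCubic G) (hb : HasUncutMatching G b) {B : Finset V}
    (hB : IsBlock G B) : ∃ p : Params, 0 ≤ p ∧ blockWeight 1 1 p = 1 ∧
      blockWeight 4 3 p = B.card ∧ ∀ (h : Sym2 V → ℝ) (α : Fin 3 → ℝ) (β γ : Fin 6 → ℝ),
      IsNeighborhoodFunction G b h α β γ → ∑ e ∈ edgesIn G B, h e = linearForm p α β γ := by
  classical
  rcases hB with ⟨u, v, x, y, h, rfl⟩ | ⟨u, v, x, h, rfl⟩
  · have nu := hG.hasNeighbors h.ab h.ac h.ad h.bc.ne h.bd.ne h.cd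
    have nv := hG.hasNeighbors h.ab.symm h.bc h.bd h.ac.ne h.ad.ne h.cd
    obtain ⟨x', nx⟩ := hG.exists_hasNeighbors₂ h.ac.symm h.bc.symm h.ab.ne
    obtain ⟨y', ny⟩ := hG.exists_hasNeighbors₂ h.ad.symm h.bd.symm h.ab.ne
    -- The outer edges of a diamond have one common neighbor only, because `x` and `y` are not
    -- adjacent.
    have hx' : y ≠ x' := fun e => h.not_cd (e ▸ nx.adj₃)
    have hy' : x ≠ y' := fun e => h.not_cd (e ▸ ny.adj₃.symm)
    refine ⟨(0, Pi.single (diamondType (b u) (b v) (b x') (b y')) 1, 0),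
      ⟨le_rfl, Pi.single_nonneg.2 zero_le_one, le_rfl⟩, by simp [blockWeight], ?_, ?_⟩
    · rw [Finset.card_insert_of_notMem (by simp [h.ab.ne, h.ac.ne, h.ad.ne]),
        Finset.card_insert_of_notMem (by simp [h.bc.ne, h.bd.ne]), Finset.card_pair h.cd]
      simp [blockWeight]
    · intro f α β γ hf
      rw [h.sum_edgesIn, hf.eq₄ nu nv, hf.eq₅ nu.swap₁₂ nx hx',
        hf.eq₅ nu.swap₂₃.swap₁₂ ny hy', hf.eq₅ nv.swap₁₂ nx.swap₁₂ hx',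
        hf.eq₅ nv.swap₂₃.swap₁₂ ny.swap₁₂ hy']
      exact linearForm_diamondType α β γ _ _ _ _ _ _ (hb.atMostOneEq nu) (hb.atMostOneEq nv)
        (hb.atMostOneEq nx) (hb.atMostOneEq ny)
  · obtain ⟨u', nu⟩ := hG.exists_hasNeighbors₂ h.ab h.ac h.bc.ne
    obtain ⟨v', nv⟩ := hG.exists_hasNeighbors₂ h.ab.symm h.bc h.ac.ne
    obtain ⟨x', nx⟩ := hG.exists_hasNeighbors₂ h.ac.symm h.bc.symm h.ab.ne
    -- A common third neighbor would produce a second triangle on an edge of the isolated one.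
    have huv : u' ≠ v' := fun e => nu.ne₂₃ (h.eq_c u' nu.adj₃ (e ▸ nv.adj₃)).symm
    have hux : u' ≠ x' := fun e => nu.ne₁₃ (h.eq_b u' nu.adj₃ (e ▸ nx.adj₃)).symm
    have hvx : v' ≠ x' := fun e => nv.ne₁₃ (h.eq_a v' nv.adj₃ (e ▸ nx.adj₃)).symm
    refine ⟨(0, 0, Pi.single (triangleType (b u) (b v) (b x) (b u') (b v') (b x')) 1),
      ⟨le_rfl, le_rfl, Pi.single_nonneg.2 zero_le_one⟩, by simp [blockWeight], ?_, ?_⟩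
    · rw [Finset.card_insert_of_notMem (by simp [h.ab.ne, h.ac.ne]), Finset.card_pair h.bc.ne]
      simp [blockWeight]
    · intro f α β γ hf
      rw [h.sum_edgesIn, hf.eq₅ nu nv huv, hf.eq₅ nu.swap₁₂ nx hux,
        hf.eq₅ nv.swap₁₂ nx.swap₁₂ hvx]
      exact linearForm_triangleType α β γ _ _ _ _ _ _ (hb.atMostOneEq nu) (hb.atMostOneEq nv)
        (hb.atMostOneEq nx)

theorem exists_type_of_mem_triangleFreeEdges (hG : IsCubic G) {e : Sym2 V}
    (he : e ∈ triangleFreeEdges G) : ∃ i : Fin 6, ∀ (h : Sym2 V → ℝ) (α : Fin 3 → ℝ)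
      (β γ : Fin 6 → ℝ), IsNeighborhoodFunction G b h α β γ → h e = γ i := by
  induction e using Sym2.ind with
  | _ u v =>
    obtain ⟨huv, hx⟩ := mem_triangleFreeEdges.1 he
    obtain ⟨x, y, nu⟩ := hG.exists_hasNeighbors₁ huv
    obtain ⟨z, w, nv⟩ := hG.exists_hasNeighbors₁ huv.symm
    refine ⟨type6 (b u) (b v) (b x) (b y) (b z) (b w), fun h α β γ hf => hf.eq₆ nu nv ?_ ?_ ?_ ?_⟩
    · rintro rfl; exact hx _ nu.adj₂ nv.adj₂
    · rintro rfl; exact hx _ nu.adj₂ nv.adj₃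
    · rintro rfl; exact hx _ nu.adj₃ nv.adj₂
    · rintro rfl; exact hx _ nu.adj₃ nv.adj₃

/-- Two of the three vertices of a triangle carry the same bit. -/
theorem IsBlock.one_le_card_uncut {B : Finset V} (hB : IsBlock G B) (c : V → Fin 2) :
    ∃ e ∈ edgesIn G B, ¬ IsCut c e := by
  have key : ∀ x y z : Fin 2, x = y ∨ x = z ∨ y = z := by decide
  obtain ⟨u, v, x, huv, hux, hvx, hu, hv, hx⟩ : ∃ u v x, G.Adj u v ∧ G.Adj u x ∧ G.Adj v x ∧
      u ∈ B ∧ v ∈ B ∧ x ∈ B := by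
    rcases hB with ⟨u, v, x, y, h, rfl⟩ | ⟨u, v, x, h, rfl⟩
    · exact ⟨u, v, x, h.ab, h.ac, h.bc, by simp, by simp, by simp⟩
    · exact ⟨u, v, x, h.ab, h.ac, h.bc, by simp, by simp, by simp⟩
  rcases key (c u) (c v) (c x) with h | h | h
  · exact ⟨s(u, v), mem_edgesIn.2 ⟨huv, hu, hv⟩, by simp [isCut_mk, h]⟩
  · exact ⟨s(u, x), mem_edgesIn.2 ⟨hux, hu, hx⟩, by simp [isCut_mk, h]⟩
  · exact ⟨s(v, x), mem_edgesIn.2 ⟨hvx, hv, hx⟩, by simp [isCut_mk, h]⟩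

/-- No edge lies in two blocks, so the uncut edges found in the blocks are distinct. This holds for
every bitstring and yields the denominator `1 - s - t`. -/
theorem cut_add_card_blocks_le (hG : IsCubic G) (hK : G.CliqueFree 4) (c : V → Fin 2) :
    cut G c + (blocks G).card ≤ (edges G).card := by
  classical
  have h1 : (blocks G).card ≤ ∑ e ∈ edges G, if IsCut c e then 0 else 1 := by
    rw [sum_edges_eq_sum_blocks hG hK, Finset.card_eq_sum_ones]
    refine le_add_right (Finset.sum_le_sum fun B hB => ?_)
    obtain ⟨e, he, hc⟩ := (mem_blocks.1 hB).one_le_card_uncut c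
    refine le_trans (by simp [hc]) (Finset.single_le_sum (fun _ _ => Nat.zero_le _) he)
  have h2 : cut G c = ∑ e ∈ edges G, if IsCut c e then 1 else 0 := by
    simpa using cut_eq_sum (R := ℕ) G c
  have h3 : (∑ e ∈ edges G, if IsCut c e then 1 else 0) +
      ∑ e ∈ edges G, (if IsCut c e then 0 else 1) = (edges G).card := by
    rw [← Finset.sum_add_distrib, Finset.card_eq_sum_ones]
    exact Finset.sum_congr rfl fun e _ => by split_ifs <;> rfl
  omega

open Classical in
theorem monochromatic_isNeighborhoodFunction (a : Fin 2) :
    IsNeighborhoodFunction G b (fun e => if ∀ v ∈ e, b v = a then 1 else 0)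
      (Pi.single (if a = 1 then 0 else 2) 1) (Pi.single (if a = 1 then 0 else 5) 1)
      (Pi.single (if a = 1 then 0 else 5) 1) where
  eq₄ {u v x y} _ _ := by
    have : ∀ a u v : Fin 2, (u = a ∧ v = a) ↔ type4 u v = if a = 1 then 0 else 2 := by decide
    simp [Pi.single_apply, this]
  eq₅ {u v x y z} _ _ _ := by
    have : ∀ a u v x y z : Fin 2,
      (u = a ∧ v = a) ↔ type5 u v x y z = if a = 1 then 0 else 5 := by decide
    simp [Pi.single_apply, this _ (b u) (b v) (b x) (b y) (b z)]
  eq₆ {u v x y z w} _ _ _ _ _ _ := by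
    have : ∀ a u v x y z w : Fin 2,
      (u = a ∧ v = a) ↔ type6 u v x y z w = if a = 1 then 0 else 5 := by decide
    simp [Pi.single_apply, this _ (b u) (b v) (b x) (b y) (b z) (b w)]

theorem card_monochromatic_add (G : SimpleGraph V) (b : V → Fin 2) :
    (monochromatic G b 0).card + (monochromatic G b 1).card + cut G b = (edges G).card := by
  classical
  rw [monochromatic, monochromatic, cut, Finset.card_filter, Finset.card_filter,
    Finset.card_filter, ← Finset.sum_add_distrib, ← Finset.sum_add_distrib,
    Finset.card_eq_sum_ones]
  refine Finset.sum_congr rfl fun e _ => ?_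
  induction e using Sym2.ind with
  | _ u v =>
    simp only [Sym2.mem_iff, forall_eq_or_imp, forall_eq, isCut_mk]
    generalize b u = x
    generalize b v = y
    fin_cases x <;> fin_cases y <;> simp

/-- The numbers of colored edge neighborhoods, diamonds and isolated triangles. -/
theorem exists_counts (hG : IsCubic G) (hK : G.CliqueFree 4) (hb : HasUncutMatching G b) :
    ∃ p : Params, 0 ≤ p ∧ blockWeight 1 1 p = (blocks G).card ∧
      blockWeight 4 3 p ≤ Fintype.card V ∧ (G.CliqueFree 3 → p.2 = 0) ∧
      ∀ (h : Sym2 V → ℝ) (α : Fin 3 → ℝ) (β γ : Fin 6 → ℝ),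
        IsNeighborhoodFunction G b h α β γ → ∑ e ∈ edges G, h e = linearForm p α β γ := by
  classical
  choose! q hq0 hq1 hq2 hq using fun (B : Finset V) (hB : B ∈ blocks G) =>
    (mem_blocks.1 hB).exists_params hG hb
  choose! i hi using fun (e : Sym2 V) (he : e ∈ triangleFreeEdges G) =>
    exists_type_of_mem_triangleFreeEdges (b := b) hG he
  have hw : ∀ x y e, blockWeight x y ((Pi.single (i e) 1, 0, 0) : Params) = 0 := by
    simp [blockWeight]
  refine ⟨∑ B ∈ blocks G, q B + ∑ e ∈ triangleFreeEdges G, (Pi.single (i e) 1, 0, 0),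
    ?_, ?_, ?_, ?_, ?_⟩
  · refine add_nonneg (Finset.sum_nonneg hq0) (Finset.sum_nonneg fun e _ => ?_)
    exact ⟨Pi.single_nonneg.2 zero_le_one, le_rfl, le_rfl⟩
  · rw [blockWeight_add, blockWeight_sum, blockWeight_sum, Finset.sum_congr rfl hq1]
    simp [hw]
  · rw [blockWeight_add, blockWeight_sum, blockWeight_sum, Finset.sum_congr rfl hq2]
    simp only [hw, Finset.sum_const_zero, add_zero]
    -- The blocks are disjoint, so together they have at most as many vertices as the graph.
    have := Finset.card_biUnion (blocks_pairwiseDisjoint hG)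
    simp only [id] at this
    exact_mod_cast this ▸ Finset.card_le_univ _
  · intro h3
    have hB : blocks G = ∅ := by
      refine Finset.eq_empty_of_forall_notMem fun B hB => ?_
      rcases mem_blocks.1 hB with ⟨u, v, x, y, h, -⟩ | ⟨u, v, x, h, -⟩ <;>
      exact h3 _ (SimpleGraph.is3Clique_triple_iff.2 ⟨h.ab, h.ac, h.bc⟩)
    rw [hB, Finset.sum_empty, zero_add, Prod.snd_sum]
    exact Finset.sum_eq_zero fun _ _ => rfl
  · intro h α β γ hf
    rw [sum_edges_eq_sum_blocks hG hK, linearForm_add, linearForm_sum, linearForm_sum]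
    congr 1
    · exact Finset.sum_congr rfl fun B hB => hq B hB h α β γ hf
    · exact Finset.sum_congr rfl fun e he => by rw [linearForm_single, hi e he h α β γ hf]

/-- The point is the vector of counts divided by the number of edges. -/
theorem exists_params (hG : IsCubic G) (hK : G.CliqueFree 4) (hb : HasUncutMatching G b) {κ : ℝ}
    (hcut : κ * (edges G).card ≤ cut G b) (hm : 0 < (edges G).card) [DecidableEq V] :
    ∃ p ∈ P κ, (∀ θ γ β, expectedCut G b θ γ β = (edges G).card * F p θ γ β) ∧
      (maxCut G : ℝ) ≤ (edges G).card * denom p ∧ (G.CliqueFree 3 → p.2 = 0) := by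
  classical
  obtain ⟨q, hq0, hq1, hq2, hq3, hq⟩ := exists_counts hG hK hb
  obtain ⟨m, hmdef⟩ : ∃ m : ℝ, m = ((edges G).card : ℝ) := ⟨_, rfl⟩
  rw [← hmdef] at hcut ⊢
  have hm0 : 0 < m := by rw [hmdef]; exact_mod_cast hm
  have hmono : ∀ a : Fin 2, ((monochromatic G b a).card : ℝ) = linearForm q
      (Pi.single (if a = 1 then 0 else 2) 1) (Pi.single (if a = 1 then 0 else 5) 1)
      (Pi.single (if a = 1 then 0 else 5) 1) := by
    intro a
    rw [← hq _ _ _ _ (monochromatic_isNeighborhoodFunction a), monochromatic, Finset.card_filter]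
    push_cast
    congr!
  have htot := hq _ _ _ _ one_isNeighborhoodFunction
  have h5 : ∀ a, 5 * ((monochromatic G b a).card : ℝ) ≤ m := fun a => by
    rw [hmdef]; exact_mod_cast five_mul_card_monochromatic_le hG hb a
  have hadd : ((monochromatic G b 0).card : ℝ) + (monochromatic G b 1).card + cut G b = m := by
    rw [hmdef]; exact_mod_cast card_monochromatic_add G b
  have hcard : 3 * (Fintype.card V : ℝ) = 2 * m := by
    rw [hmdef]; exact_mod_cast three_mul_card hG
  have hmax : (maxCut G : ℝ) + (blocks G).card ≤ m := by
    obtain ⟨c, -, hc⟩ := Finset.exists_mem_eq_sup Finset.univ Finset.univ_nonempty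
      (fun c : V → Fin 2 => cut G c)
    rw [maxCut, hc, hmdef]
    exact_mod_cast cut_add_card_blocks_le hG hK c
  obtain ⟨hr, hs, ht⟩ : (∀ i, 0 ≤ q.1 i) ∧ (∀ i, 0 ≤ q.2.1 i) ∧ ∀ i, 0 ≤ q.2.2 i :=
    ⟨hq0.1, hq0.2.1, hq0.2.2⟩
  have h50 := h5 0
  have h51 := h5 1
  rw [hmono 0] at hadd h50
  rw [hmono 1] at hadd h51
  rw [Finset.sum_const, nsmul_one, ← hmdef] at htot
  simp only [linearForm, blockWeight, Fin.sum_univ_six, Fin.sum_univ_seven, Fin.sum_univ_four]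
    at htot hadd h50 h51 hq1 hq2
  simp at htot hadd h50 h51
  have hinv : 0 ≤ m⁻¹ := (inv_pos.2 hm0).le
  have key : ∀ {x y : ℝ}, x ≤ y * m → m⁻¹ * x ≤ y := fun {x y} h => by
    rw [inv_mul_le_iff₀ hm0]; linarith
  refine ⟨m⁻¹ • q, ⟨fun i => mul_nonneg hinv (hr i), fun i => mul_nonneg hinv (hs i),
    fun i => mul_nonneg hinv (ht i), ?_, ?_, ?_, ?_, ?_⟩, ?_, ?_, ?_⟩
  · simp only [Prod.smul_fst, Prod.smul_snd, Pi.smul_apply, smul_eq_mul, ← Finset.mul_sum,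
      Fin.sum_univ_six, Fin.sum_univ_seven, Fin.sum_univ_four]
    rw [← inv_mul_cancel₀ hm0.ne', htot]
    ring
  · simp only [Prod.smul_fst, Prod.smul_snd, Pi.smul_apply, smul_eq_mul, ← Finset.mul_sum,
      Fin.sum_univ_seven, Fin.sum_univ_four]
    refine le_trans (le_of_eq ?_) (key (y := 2 / 3) (hq2.trans (by linarith)))
    ring
  -- The entry `r₁` is one summand of the number of uncut edges of color 1, the others being
  -- nonnegative.
  · exact key (by linarith [hs 1, hs 5, hs 2, hs 3, ht 0, ht 1])
  · exact key (by linarith [hs 0, hs 4, hs 6, hs 3, ht 2, ht 3])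
  -- Diamonds of kind `s₁₂` contain two uncut edges and every other block one, so the left side
  -- counts all uncut edges.
  · simp only [Prod.smul_fst, Prod.smul_snd, Pi.smul_apply, smul_eq_mul, ← Finset.mul_sum,
      Fin.sum_univ_seven, Fin.sum_univ_four]
    simp only [← mul_add]
    exact key (by linarith)
  · intro θ γ β
    rw [expectedCut_eq_sum, hq _ _ _ _ (edgeCutProb_isNeighborhoodFunction hb θ γ β),
      F_eq_linearForm, linearForm_smul, mul_inv_cancel_left₀ hm0.ne']
  · have : denom (m⁻¹ • q) = 1 - m⁻¹ * (blocks G).card := by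
      simp only [denom, Prod.smul_fst, Prod.smul_snd, Pi.smul_apply, smul_eq_mul,
        ← Finset.mul_sum, Fin.sum_univ_seven, Fin.sum_univ_four, ← hq1]
      ring
    rw [this, mul_sub, mul_inv_cancel_left₀ hm0.ne']
    linarith
  · intro h3
    rw [Prod.smul_snd, hq3 h3, smul_zero]

theorem le_warmStartRatio (hG : IsCubic G) (hK : G.CliqueFree 4) (hb : HasUncutMatching G b)
    {κ : ℝ} (hcut : κ * (edges G).card ≤ cut G b) (hm : 0 < (edges G).card) [DecidableEq V]
    (θ : ℝ) : ∃ p ∈ P κ, M θ p / denom p ≤ warmStartRatio G b θ ∧ (G.CliqueFree 3 → p.2 = 0) := by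
  obtain ⟨p, hp, hF, hmax, h3⟩ := exists_params hG hK hb hcut hm
  refine ⟨p, hp, ?_, h3⟩
  have hm0 : (0 : ℝ) < (edges G).card := by exact_mod_cast hm
  have hMopt : (edges G).card * M θ p ≤ optExpectedCut G b θ := by
    obtain ⟨x, hx⟩ := (isGreatest_M θ p).1
    rw [← hx]
    simp only [← hF]
    exact (isGreatest_optExpectedCut G b θ).2 ⟨x, rfl⟩
  have hopt : 0 ≤ optExpectedCut G b θ := by
    refine le_trans ?_ ((isGreatest_optExpectedCut G b θ).2 ⟨(0, 0), rfl⟩)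
    simp only [expectedCut_eq_sum]
    exact Finset.sum_nonneg fun e _ => edgeCutProb_nonneg G b e θ 0 0
  have hmaxpos : (0 : ℝ) < maxCut G := by
    obtain ⟨e, he⟩ := Finset.card_pos.1 hm
    induction e using Sym2.ind with
    | _ u v =>
      classical
      have huv : G.Adj u v := by simpa [mem_edges] using he
      have h1 : 0 < cut G (fun w => if w = u then (1 : Fin 2) else 0) :=
        Finset.card_pos.2 ⟨s(u, v), Finset.mem_filter.2 ⟨he, by simp [isCut_mk, huv.ne.symm]⟩⟩
      exact_mod_cast h1.trans_le (Finset.le_sup (f := fun c : V → Fin 2 => cut G c)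
        (Finset.mem_univ _))
  rw [warmStartRatio, div_le_div_iff₀ (denom_pos hp) hmaxpos]
  have hd := denom_pos hp
  have h1 : M θ p * ((edges G).card * denom p) ≤ optExpectedCut G b θ * denom p := by
    calc _ = (edges G).card * M θ p * denom p := by ring
      _ ≤ _ := mul_le_mul_of_nonneg_right hMopt hd.le
  -- Nonnegativity is needed to multiply the upper bound on the maximum cut by `M`.
  have hM : 0 ≤ M θ p := by
    refine le_trans ?_ (F_le_M θ p (0, 0))
    have := hF θ 0 0
    rw [expectedCut_eq_sum] at this
    refine nonneg_of_mul_nonneg_right (a := ((edges G).card : ℝ)) ?_ hm0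
    rw [← this]
    exact Finset.sum_nonneg fun e _ => edgeCutProb_nonneg G b e θ 0 0
  exact (mul_le_mul_of_nonneg_left hmax hM).trans h1

end Counting

/-! ### From single cuts to algorithms and classes of graphs -/

section Algorithms

theorem le_instanceRatio {A : CutAlgorithm} {θ c : ℝ} {G : Graph}
    (h : ∀ b ∈ (A G).support, c ≤ warmStartRatio G.2 b θ) : c ≤ instanceRatio A θ G := by
  have hsum : ∑ b, ((A G) b).toReal = 1 := by
    have := (A G).tsum_coe
    rw [tsum_fintype] at this
    rw [← ENNReal.toReal_sum fun b _ => (A G).apply_ne_top b, this, ENNReal.toReal_one]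
  rw [instanceRatio, ← one_mul c, ← hsum, Finset.sum_mul]
  refine Finset.sum_le_sum fun b _ => ?_
  by_cases hb : b ∈ (A G).support
  · exact mul_le_mul_of_nonneg_left (h b hb) ENNReal.toReal_nonneg
  · rw [PMF.mem_support_iff, not_not] at hb
    simp [hb]

/-- The real `sInf` takes a default value on sets that are empty or unbounded below; the
greatest-lower-bound claim certifies a genuine infimum. -/
theorem approxRatio_ge {A : CutAlgorithm} {θ c : ℝ} {𝒢 : Set Graph} (hne : 𝒢.Nonempty)
    (h : ∀ G ∈ 𝒢, c ≤ instanceRatio A θ G) :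
    IsGLB (instanceRatio A θ '' 𝒢) (approxRatio A θ 𝒢) ∧ approxRatio A θ 𝒢 ≥ c := by
  have hc : c ∈ lowerBounds (instanceRatio A θ '' 𝒢) := by
    rintro _ ⟨G, hG, rfl⟩
    exact h G hG
  have hglb := isGLB_csInf (hne.image (instanceRatio A θ)) ⟨c, hc⟩
  exact ⟨hglb, hglb.2 hc⟩

theorem IsTypeA.exists_params {κ : ℝ} {𝒢 : Set Graph} {A : CutAlgorithm} (hA : IsTypeA κ 𝒢 A)
    {G : Graph} (hG : G ∈ 𝒢) (hpos : 0 < G.1) (hK : G.2.CliqueFree 4) {b : Fin G.1 → Fin 2}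
    (hb : b ∈ (A G).support) (θ : ℝ) :
    ∃ p ∈ P κ, M θ p / denom p ≤ warmStartRatio G.2 b θ ∧ (G.2.CliqueFree 3 → p.2 = 0) := by
  obtain ⟨hreg, h⟩ := hA G hG
  obtain ⟨hcut, hbls⟩ := h b hb
  have hcubic := IsCubic.of_isRegularOfDegree hreg
  -- With `3n = 2m`, a nonempty vertex set forces an edge, so the fraction of cut edges is a genuine
  -- quotient.
  have hm : 0 < (edges G.2).card := by
    have := three_mul_card hcubic
    rw [Fintype.card_fin] at this
    omega
  refine le_warmStartRatio hcubic hK (hasUncutMatching_of_isBLSOptimal hcubic hbls) ?_ hm θ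
  rwa [le_div_iff₀ (by exact_mod_cast hm)] at hcut

end Algorithms

end WarmStartQAOA

end

/-! ### The two chains of inequalities -/

open WarmStartQAOA in
theorem mainTheorem1 (κ θ : ℝ) (hκ : κ ≤ 1) :
    -- all maxima and minima below are attained
    ((∀ p : Params, IsGreatest (Set.range fun x : ℝ × ℝ => F p θ x.1 x.2) (M θ p)) ∧
      (∀ (G : Graph) (b : Fin G.1 → Fin 2),
        IsGreatest (Set.range fun x : ℝ × ℝ => expectedCut G.2 b θ x.1 x.2)
          (optExpectedCut G.2 b θ)) ∧
      IsLeast ((fun p => M θ p / denom p) '' P κ) (minMax κ θ) ∧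
      (∀ x : ℝ × ℝ, IsLeast ((fun p => F p θ x.1 x.2 / denom p) '' P κ) (innerMin κ θ x)) ∧
      IsGreatest (Set.range (innerMin κ θ)) (LB κ θ) ∧
      IsLeast ((fun r => M θ (r, 0, 0)) '' P' κ) (minMax' κ θ) ∧
      (∀ x : ℝ × ℝ, IsLeast ((fun r => F (r, 0, 0) θ x.1 x.2) '' P' κ) (innerMin' κ θ x)) ∧
      IsGreatest (Set.range (innerMin' κ θ)) (LB' κ θ)) ∧
    -- the chain for algorithms of type `𝒜_κ`
    ((∀ (𝒢 : Set Graph) (A : CutAlgorithm), 𝒢.Nonempty → (∀ G ∈ 𝒢, 0 < G.1) →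
        (∀ G ∈ 𝒢, G.2.CliqueFree 4) → IsTypeA κ 𝒢 A →
        IsGLB (instanceRatio A θ '' 𝒢) (approxRatio A θ 𝒢) ∧
          approxRatio A θ 𝒢 ≥ minMax κ θ) ∧
      minMax κ θ ≥ LB κ θ) ∧
    -- the chain for algorithms of type `𝒜'_κ`
    ((∀ (𝒢 : Set Graph) (A : CutAlgorithm), 𝒢.Nonempty → (∀ G ∈ 𝒢, 0 < G.1) →
        IsTypeA' κ 𝒢 A →
        IsGLB (instanceRatio A θ '' 𝒢) (approxRatio A θ 𝒢) ∧
          approxRatio A θ 𝒢 ≥ minMax' κ θ) ∧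
      minMax' κ θ ≥ LB' κ θ) := by
  refine ⟨⟨isGreatest_M θ, fun G b => isGreatest_optExpectedCut G.2 b θ, isLeast_minMax hκ θ,
    isLeast_innerMin hκ θ, isGreatest_LB κ θ, isLeast_minMax' hκ θ, isLeast_innerMin' hκ θ,
    isGreatest_LB' κ θ⟩, ⟨?_, LB_le_minMax hκ θ⟩, ⟨?_, LB'_le_minMax' hκ θ⟩⟩
  · intro 𝒢 A hne hpos hK hA
    refine approxRatio_ge hne fun G hG => le_instanceRatio fun b hb => ?_
    obtain ⟨p, hp, h, -⟩ := hA.exists_params hG (hpos G hG) (hK G hG) hb θ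
    exact ((isLeast_minMax hκ θ).2 ⟨p, hp, rfl⟩).trans h
  · intro 𝒢 A hne hpos hA
    refine approxRatio_ge hne fun G hG => le_instanceRatio fun b hb => ?_
    obtain ⟨⟨r, q⟩, hp, h, h3⟩ := hA.1.exists_params hG (hpos G hG)
      ((hA.2 G hG).mono (by norm_num)) hb θ
    obtain rfl : q = 0 := h3 (hA.2 G hG)
    refine ((isLeast_minMax' hκ θ).2 ⟨r, mk_zero_mem_P_iff.1 hp, rfl⟩).trans ?_
    have hd : denom (r, 0) = 1 := by simp [denom]
    rwa [hd, div_one] at h
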